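/- A standard (resp. reverse standard) Young tableau with $m$ cells is a filling of the cells of the Young diagram of a partition of $m$ with $1,\dots,m$, each used once, whose entries increase (resp. decrease) along every row and every column. For $0\le t\le k$ let $\mathcal S_m^{(k,t)}$ be the set of standard Young tableaux with $m$ cells, at most $k$ rows and exactly $t$ rows of odd length. Let $\mathfrak D_m^{(k)}={}_0\mathfrak D_m^{(k)}$ be the set of reverse standard Young tableaux with $m$ cells and at most $k$ rows whose shape is almost even, i.e. has exactly one odd part if $m$ is odd, and exactly two odd parts if $m$ is even. Let $\mathsf C_m=\frac1{m+1}\binom{2m}{m}$ be the Catalan numbers. Let $\mathsf R_m$ be the Riordan numbers: $\mathsf R_m$ is the number of lattice paths from $(0,0)$ to $(m,0)$ with steps $(1,1),(1,0),(1,-1)$ that never go below the $x$-axis and have no horizontal step on the $x$-axis. Explicitly, $\mathsf R_0=1$ and $$\mathsf R_m=\frac1{m+1}\sum_{i=1}^{\lfloor m/2\rfloor}\binom{m+1}{i}\binom{m-i-1}{i-1}\qquad(m\ge1).$$ **Theorem.** The numbers $|\mathcal S_m^{(k,t)}|$, $0\le t\le k\le5$, and $|\mathfrak D_m^{(k)}|$,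 $k\le5$, are as follows. Formulas hold for all integers $m\ge 0$, except that $m\ge1$ is assumed in those containing an index $2m-1$ or $2m-2$, in all formulas for $k=2$, and in the factorial expression for $k=4$. Degenerate cases: $\mathcal S_m^{(k,t)}=\emptyset$ if $m\not\equiv t \pmod 2$; $|\mathcal S_0^{(k,0)}|=1$, $\mathcal S_0^{(k,t)}=\emptyset$ for $t\ge1$, and $\mathfrak D_0^{(k)}=\emptyset$; $\mathcal S_m^{(0,0)}=\mathfrak D_m^{(0)}=\emptyset$ for $m\ge1$; $|\mathcal S_{2m}^{(1,0)}|=|\mathcal S_{2m-1}^{(1,1)}|=|\mathfrak D_{2m-1}^{(1)}|=1$ and $\mathfrak D_{2m}^{(1)}=\emptyset$. For $k=2$: $$|\mathcal S^{(2,0)}_{2m}|=|\mathcal S^{(2,1)}_{2m-1}|=|\mathcal S^{(2,2)}_{2m}|=|\mathfrak D^{(2)}_{2m-1}|=|\mathfrak D^{(2)}_{2m}|=\binom{2m-1}{m}.$$ For $k=3$: $$|\mathcal S^{(3,0)}_{2m}|=|\mathcal S^{(3,1)}_{2m-1}|=|\mathfrak D^{(3)}_{2m-1}|=\mathsf R_{2m},\qquad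 |\mathcal S^{(3,2)}_{2m}|=|\mathcal S^{(3,3)}_{2m+1}|=|\mathfrak D^{(3)}_{2m}|=\mathsf R_{2m+1}.$$ (Here the values at index $2m$ or $2m+1$ hold for all $m\ge0$, those at index $2m-1$ for $m\ge1$; the same convention applies to the chains below.) For $k=4$: $$|\mathcal S^{(4,0)}_{2m}|=|\mathcal S^{(4,1)}_{2m-1}|=|\mathfrak D^{(4)}_{2m-1}|=\binom{\mathsf C_m+1}2,$$ $$|\mathcal S^{(4,2)}_{2m}|=|\mathfrak D^{(4)}_{2m}|=\mathsf C_m\mathsf C_{m+1}-\mathsf C_m^2=\frac{3\,(2m)!^2}{(m-1)!\,m!\,(m+1)!\,(m+2)!},$$ $$|\mathcal S^{(4,3)}_{2m-1}|=|\mathcal S^{(4,4)}_{2m}|=\binom{\mathsf C_m}2.$$ For $k=5$: $$|\mathcal S^{(5,0)}_{2m}|=|\mathcal S^{(5,1)}_{2m-1}|=|\mathfrak D^{(5)}_{2m-1}|=\sum_{i=0}^{m}\binom{2m}{2i}\mathsf C_i\mathsf C_{i+1}-\sum_{i=0}^{m-1}\binom{2m}{2i+1}\mathsf C_{i+1}^2,$$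 $$|\mathcal S^{(5,2)}_{2m}|=|\mathfrak D^{(5)}_{2m}|=\sum_{i=0}^{m}\frac{2i}{i+3}\binom{2m}{2i}\mathsf C_i\mathsf C_{i+1}-\sum_{i=0}^{m-1}\frac{2i}{i+3}\binom{2m}{2i+1}\mathsf C_{i+1}^2,$$ $$|\mathcal S^{(5,3)}_{2m-1}|=\sum_{i=0}^{m-1}\frac{2i}{i+3}\binom{2m-1}{2i}\mathsf C_i\mathsf C_{i+1}-\sum_{i=0}^{m-1}\frac{2i}{i+3}\binom{2m-1}{2i+1}\mathsf C_{i+1}^2,$$ $$|\mathcal S^{(5,4)}_{2m-2}|=|\mathcal S^{(5,5)}_{2m-1}|=\sum_{i=0}^{m-1}\binom{2m-1}{2i}\mathsf C_i\mathsf C_{i+1}-\sum_{i=0}^{m-1}\binom{2m-1}{2i+1}\mathsf C_{i+1}^2.$$ -/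

import Mathlib

/-- A tableau of shape `μ`: a filling of the `m = μ.card` cells of the Young diagram `μ` with the
integers `1, 2, …, m`, each used once. The cell `(i, j)` lies in row `i` and column `j`, both
counted from `0`; as a normalisation the entry is `0` outside the diagram. -/
@[ext]
structure YTableau (μ : YoungDiagram) where
  entry : ℕ → ℕ → ℕ
  zeros : ∀ i j, (i, j) ∉ μ → entry i j = 0
  bijOn : Set.BijOn (fun c : ℕ × ℕ => entry c.1 c.2) {c | c ∈ μ} (Set.Icc 1 μ.card)

namespace YTableau

/-- Standard: the entries increase along each row and each column. -/
def IsStandard {μ : YoungDiagram} (T : YTableau μ) : Prop :=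
  (∀ i j₁ j₂, j₁ < j₂ → (i, j₂) ∈ μ → T.entry i j₁ < T.entry i j₂) ∧
  (∀ i₁ i₂ j, i₁ < i₂ → (i₂, j) ∈ μ → T.entry i₁ j < T.entry i₂ j)

/-- Reverse standard: the entries decrease along each row and each column. -/
def IsReverseStandard {μ : YoungDiagram} (T : YTableau μ) : Prop :=
  (∀ i j₁ j₂, j₁ < j₂ → (i, j₂) ∈ μ → T.entry i j₂ < T.entry i j₁) ∧
  (∀ i₁ i₂ j, i₁ < i₂ → (i₂, j) ∈ μ → T.entry i₂ j < T.entry i₁ j)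

end YTableau

/-- The number of odd parts of a sequence of nonnegative integers. -/
def numOdd (l : List ℕ) : ℕ := l.countP (fun a => decide (Odd a))

/-- Almost even compositions: exactly one odd part if the total is odd, exactly two odd parts if
the total is even. -/
def AlmostEven (l : List ℕ) : Prop :=
  (Odd l.sum ∧ numOdd l = 1) ∨ (Even l.sum ∧ numOdd l = 2)

/-- `𝒮_m^{(k,t)}`: standard Young tableaux with `m` cells, at most `k` rows and exactly `t` rows of
odd length. (`μ.rowLens` is the list of the lengths of the nonempty rows of `μ`.) -/
def SYTOdd (k t m : ℕ) : Set (Σ μ : YoungDiagram, YTableau μ) :=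
  {T | T.2.IsStandard ∧ T.1.card = m ∧ T.1.rowLens.length ≤ k ∧ numOdd T.1.rowLens = t}

/-- `𝔇_m^{(k)}`: reverse standard Young tableaux with `m` cells and at most `k` rows, of almost even
shape. -/
def AlmostEvenTableaux (k m : ℕ) : Set (Σ μ : YoungDiagram, YTableau μ) :=
  {T | T.2.IsReverseStandard ∧ T.1.card = m ∧ T.1.rowLens.length ≤ k ∧ AlmostEven T.1.rowLens}

/-- There are finitely many tableaux with `m` cells. -/
theorem finite_YTableau (m : ℕ) : {T : Σ μ : YoungDiagram, YTableau μ | T.1.card = m}.Finite := by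
  let F : (Σ μ : YoungDiagram, YTableau μ) → (Fin m × Fin m → Fin (m + 1)) :=
    fun T c => Fin.ofNat (m + 1) (T.2.entry c.1 c.2)
  refine Set.Finite.of_injOn (f := F) (t := Set.univ) (fun _ _ => Set.mem_univ _) ?_
    Set.finite_univ
  have row : ∀ (μ : YoungDiagram) (i j : ℕ), (i, j) ∈ μ → i < μ.card ∧ j < μ.card := by
    intro μ i j h
    constructor
    · refine lt_of_lt_of_le (YoungDiagram.mem_iff_lt_colLen.1 h) ?_
      rw [YoungDiagram.colLen_eq_card]
      exact Finset.card_le_card (Finset.filter_subset _ _)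
    · refine lt_of_lt_of_le (YoungDiagram.mem_iff_lt_rowLen.1 h) ?_
      rw [YoungDiagram.rowLen_eq_card]
      exact Finset.card_le_card (Finset.filter_subset _ _)
  have mem : ∀ (μ : YoungDiagram) (T : YTableau μ) (i j : ℕ), (i, j) ∈ μ ↔ T.entry i j ≠ 0 := by
    intro μ T i j
    constructor
    · intro h
      have := (T.bijOn.mapsTo (x := (i, j)) h).1
      simp only at this
      omega
    · intro h
      by_contra h'
      exact h (T.zeros i j h')
  have le : ∀ (μ : YoungDiagram) (T : YTableau μ) (i j : ℕ), T.entry i j ≤ μ.card := by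
    intro μ T i j
    by_cases h : (i, j) ∈ μ
    · exact (T.bijOn.mapsTo (x := (i, j)) h).2
    · simp [T.zeros i j h]
  rintro ⟨μ, T⟩ hT ⟨ν, U⟩ hU hF
  simp only [Set.mem_ofPred_eq] at hT hU
  have key : T.entry = U.entry := by
    funext i j
    by_cases hij : i < m ∧ j < m
    · have h := congrArg Fin.val (congrFun hF (⟨i, hij.1⟩, ⟨j, hij.2⟩))
      have h1 := le μ T i j
      have h2 := le ν U i j
      simp only [F, Fin.val_ofNat] at h
      rwa [Nat.mod_eq_of_lt (by omega), Nat.mod_eq_of_lt (by omega)] at h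
    · rw [T.zeros i j (fun h => hij (hT ▸ row μ i j h)),
        U.zeros i j (fun h => hij (hU ▸ row ν i j h))]
  have hμν : μ = ν := by
    ext ⟨i, j⟩
    simp only [YoungDiagram.mem_cells]
    rw [mem μ T, mem ν U, key]
  subst hμν
  have : T = U := YTableau.ext key
  rw [this]

theorem finite_SYTOdd (k t m : ℕ) : (SYTOdd k t m).Finite :=
  (finite_YTableau m).subset fun _ h => h.2.1

theorem finite_AlmostEvenTableaux (k m : ℕ) : (AlmostEvenTableaux k m).Finite :=
  (finite_YTableau m).subset fun _ h => h.2.1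

/-- A Riordan path from `(0, 0)` to `(m, 0)`, given by its heights at the abscissas `0, …, m`: each
step changes the height by `1`, `0` or `-1`, the path stays at height `≥ 0` (the heights are natural
numbers), and no horizontal step lies on the axis. -/
def IsRiordanPath (m : ℕ) (h : Fin (m + 1) → ℕ) : Prop :=
  h 0 = 0 ∧ h (Fin.last m) = 0 ∧
  ∀ i : Fin m,
    (h i.succ = h i.castSucc + 1 ∨ h i.succ = h i.castSucc ∨ h i.succ + 1 = h i.castSucc) ∧
    ¬ (h i.castSucc = 0 ∧ h i.succ = 0)

/-- The `m`-th Riordan number: the number of Riordan paths from `(0, 0)` to `(m, 0)`. -/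
noncomputable def riordan (m : ℕ) : ℕ := {h : Fin (m + 1) → ℕ | IsRiordanPath m h}.ncard

theorem finite_riordanPaths (m : ℕ) : {h : Fin (m + 1) → ℕ | IsRiordanPath m h}.Finite := by
  refine (Set.finite_Iic (fun _ : Fin (m + 1) => m)).subset ?_
  intro h hh i
  have key : ∀ n (hn : n < m + 1), h ⟨n, hn⟩ ≤ n := by
    intro n
    induction n with
    | zero => intro hn; exact (le_of_eq hh.1)
    | succ n ih =>
      intro hn
      have h1 := ih (by omega)
      have h2 := (hh.2.2 ⟨n, by omega⟩).1
      simp only [Fin.succ_mk, Fin.castSucc_mk] at h2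
      omega
  exact (key i.1 i.2).trans (Nat.le_of_lt_succ i.2)

/-! The source of the formulas is integration over the orthogonal group. The integral of a Schur
function `s_λ` over `O(k)` is `1` if all rows of `λ` are even and `0` otherwise. By Pieri's rule,
multiplying by `e_t` adds vertical strips of `t` cells, and a strip makes all rows even exactly when
it has one cell in each odd row and none elsewhere; so the integral of `e_t s_λ` detects shapes with
`t` odd rows. Summing `s_λ` over the standard tableaux with `m` cells gives the `m`-th power of the
trace, so the count is the integral of `e_t(g) tr(g)^m`.

On the component of determinant `1`, shapes with all rows odd contribute as well, so the values `t`
and `k - t` appear added together; on the component of determinant `-1` they appear with opposite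
signs. For odd `k` the parity of `m` separates them. For `k = 2, 4` the other component supplies the
difference, except in the middle case `t = k / 2`, where the two coincide.

The proof makes this algebraic. A weight `F` on row lengths stands for `s_λ` times the Weyl density:
it is the alternant in the shifted row lengths at the eigenvalues of `g`, divided by the obvious
factors `x - x⁻¹`. Being an alternant, it obeys Pieri's rule and vanishes when two shifted lengths
agree, so its sum over tableaux is `p ^ m * F 0` with `p` the trace (`sum_standardTableaux_eq_pow`).
The integral is a constant term, which depends only on the parities of the row lengths;
`ncard_SYTOdd_add` combines the two facts.

It remains to evaluate constant terms. For `k = 4, 5` put `x = a b`, `y = a b⁻¹`, the double cover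
of `SO(4)` by two copies of `SU(2)`: trace and density of `SO(4)` then factor, and semicircle
moments, i.e. Catalan numbers, appear. For `k = 5` the density has the further factor `(A - B) ^ 2`
with `A = a + a⁻¹`, `B = b + b⁻¹`. For `k = 3`, Riordan paths are walks on the irreducible
representations of `SO(3)` under tensoring with the standard one. Their closed form follows from a
telescoping sum. -/

namespace YoungDiagram

/-! ### Adding a cell to a Young diagram. -/

theorem rowLen_eq_of_forall {μ : YoungDiagram} {i n : ℕ} (h : ∀ j, (i, j) ∈ μ ↔ j < n) :
    μ.rowLen i = n :=
  eq_of_forall_lt_iff fun j => by rw [← mem_iff_lt_rowLen, h]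

/-- A new cell may be added at the end of row `i`. -/
def Addable (μ : YoungDiagram) (i : ℕ) : Prop := ∀ i' < i, μ.rowLen i < μ.rowLen i'

/-- The diagram with one more cell at the end of row `i`. -/
def addCell (μ : YoungDiagram) (i : ℕ) (h : μ.Addable i) : YoungDiagram where
  cells := insert (i, μ.rowLen i) μ.cells
  isLowerSet := by
    rintro ⟨a, b⟩ ⟨c, d⟩ ⟨hca, hdb⟩ hab
    simp only at hca hdb
    simp only [Finset.coe_insert, Set.mem_insert_iff, Finset.mem_coe, mem_cells, Prod.mk.injEq]
      at hab ⊢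
    rcases hab with ⟨rfl, rfl⟩ | hab
    · rcases hca.lt_or_eq with hlt | rfl
      · exact Or.inr (mem_iff_lt_rowLen.2 (hdb.trans_lt (h c hlt)))
      · rcases hdb.lt_or_eq with hlt | rfl
        · exact Or.inr (mem_iff_lt_rowLen.2 hlt)
        · exact Or.inl ⟨rfl, rfl⟩
    · exact Or.inr (μ.up_left_mem hca hdb hab)

theorem mem_addCell {μ : YoungDiagram} {i : ℕ} {h : μ.Addable i} {c : ℕ × ℕ} :
    c ∈ μ.addCell i h ↔ c = (i, μ.rowLen i) ∨ c ∈ μ := by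
  rw [← mem_cells, addCell, Finset.mem_insert, mem_cells]

theorem mk_rowLen_notMem (μ : YoungDiagram) (i : ℕ) : (i, μ.rowLen i) ∉ μ := by
  simp [mem_iff_lt_rowLen]

theorem card_addCell {μ : YoungDiagram} {i : ℕ} {h : μ.Addable i} :
    (μ.addCell i h).card = μ.card + 1 :=
  Finset.card_insert_of_notMem (by simpa using μ.mk_rowLen_notMem i)

theorem rowLen_addCell {μ : YoungDiagram} {i : ℕ} {h : μ.Addable i} :
    (μ.addCell i h).rowLen = Function.update μ.rowLen i (μ.rowLen i + 1) := by
  funext i'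
  refine rowLen_eq_of_forall fun j => ?_
  rw [mem_addCell, mem_iff_lt_rowLen, Prod.mk.injEq]
  by_cases hi : i' = i
  · subst hi
    simp only [true_and, Function.update_self]
    omega
  · simp [hi]

theorem rowLens_length_le_iff {μ : YoungDiagram} {k : ℕ} :
    μ.rowLens.length ≤ k ↔ μ.rowLen k = 0 := by
  rw [length_rowLens, ← not_lt, ← mem_iff_lt_colLen, mem_iff_lt_rowLen]
  omega

end YoungDiagram

/-! ### Odd rows counted through row lengths. -/

open YoungDiagram

/-- The number of odd values among `f 0, …, f (k - 1)`. -/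
def oddCount (k : ℕ) (f : ℕ → ℕ) : ℕ := ∑ i ∈ Finset.range k, f i % 2

theorem numOdd_eq_sum (l : List ℕ) : numOdd l = (l.map (· % 2)).sum := by
  induction l with
  | nil => rfl
  | cons a l ih =>
    rw [numOdd, List.countP_cons, ← numOdd, ih, List.map_cons, List.sum_cons]
    rcases Nat.mod_two_eq_zero_or_one a with h | h <;> simp [Nat.odd_iff, h, add_comm]

theorem numOdd_rowLens {μ : YoungDiagram} {k : ℕ} (h : μ.rowLen k = 0) :
    numOdd μ.rowLens = oddCount k μ.rowLen := by
  have hk : μ.colLen 0 ≤ k := by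
    rw [← length_rowLens]
    exact rowLens_length_le_iff.2 h
  rw [numOdd_eq_sum, rowLens, List.map_map, oddCount, ← Finset.sum_subset
    (Finset.range_subset_range.2 hk)]
  · rfl
  · intro i _ hi
    have hnot : (i, 0) ∉ μ := by
      rw [mem_iff_lt_colLen]
      simpa using hi
    rw [mem_iff_lt_rowLen] at hnot
    simp [Nat.eq_zero_of_not_pos hnot]

theorem card_eq_sum_rowLen {μ : YoungDiagram} {k : ℕ} (h : μ.rowLen k = 0) :
    μ.card = ∑ i ∈ Finset.range k, μ.rowLen i := by
  have hmaps : ∀ c ∈ μ.cells, c.1 ∈ Finset.range k := by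
    rintro ⟨i, j⟩ hc
    rw [Finset.mem_range]
    by_contra hle
    have h1 := μ.rowLen_anti k i (not_lt.1 hle)
    have h2 := mem_iff_lt_rowLen.1 ((mem_cells _).1 hc)
    omega
  rw [YoungDiagram.card, Finset.card_eq_sum_card_fiberwise hmaps]
  refine Finset.sum_congr rfl fun i _ => ?_
  rw [rowLen_eq_card]
  rfl

theorem oddCount_mod_two {μ : YoungDiagram} {k : ℕ} (h : μ.rowLen k = 0) :
    oddCount k μ.rowLen % 2 = μ.card % 2 := by
  rw [card_eq_sum_rowLen h, oddCount, ← Finset.sum_nat_mod]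

/-! ### Operations on tableaux: adding and removing the largest entry, complementing. -/

namespace YTableau

variable {μ : YoungDiagram}

theorem mem_iff_entry_ne_zero (T : YTableau μ) {i j : ℕ} : (i, j) ∈ μ ↔ T.entry i j ≠ 0 := by
  refine ⟨fun h => ?_, fun h => ?_⟩
  · have h1 : 1 ≤ T.entry i j := (T.bijOn.mapsTo (x := (i, j)) h).1
    omega
  · by_contra hn
    exact h (T.zeros i j hn)

theorem entry_le_card (T : YTableau μ) (i j : ℕ) : T.entry i j ≤ μ.card := by
  by_cases h : (i, j) ∈ μ
  · exact (T.bijOn.mapsTo (x := (i, j)) h).2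
  · simp [T.zeros i j h]

/-- The shape is the support of the entry function, so the dependent pair carries no further data.
-/
theorem sigma_ext {T U : Σ μ : YoungDiagram, YTableau μ} (h : T.2.entry = U.2.entry) : T = U := by
  obtain ⟨μ, T⟩ := T
  obtain ⟨ν, U⟩ := U
  simp only at h
  have hμν : μ = ν := by
    ext ⟨i, j⟩
    rw [mem_cells, mem_cells, T.mem_iff_entry_ne_zero, U.mem_iff_entry_ne_zero, h]
  subst hμν
  rw [YTableau.ext h]

theorem IsStandard.entry_lt {T : YTableau μ} (hT : T.IsStandard) {i₁ i₂ j₁ j₂ : ℕ}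
    (hi : i₁ ≤ i₂) (hj : j₁ ≤ j₂) (hne : (i₁, j₁) ≠ (i₂, j₂)) (hmem : (i₂, j₂) ∈ μ) :
    T.entry i₁ j₁ < T.entry i₂ j₂ := by
  rcases hi.lt_or_eq with hi | rfl
  · have h1 := hT.2 i₁ i₂ j₂ hi hmem
    rcases hj.lt_or_eq with hj | rfl
    · exact (hT.1 i₁ j₁ j₂ hj (μ.up_left_mem hi.le le_rfl hmem)).trans h1
    · exact h1
  · rcases hj.lt_or_eq with hj | rfl
    · exact hT.1 i₁ j₁ j₂ hj hmem
    · exact absurd rfl hne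

/-- Add a cell with the largest entry at the end of row `i`. -/
def extend (T : YTableau μ) (i : ℕ) (h : μ.Addable i) : YTableau (μ.addCell i h) where
  entry a b := if (a, b) = (i, μ.rowLen i) then μ.card + 1 else T.entry a b
  zeros a b hab := by
    rw [mem_addCell, not_or] at hab
    rw [if_neg hab.1, T.zeros a b hab.2]
  bijOn := by
    have hset : {c | c ∈ μ.addCell i h} = insert (i, μ.rowLen i) {c | c ∈ μ} := by
      ext c
      exact mem_addCell
    have hIcc : Set.Icc 1 (μ.addCell i h).card = insert (μ.card + 1) (Set.Icc 1 μ.card) := by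
      rw [card_addCell]
      ext x
      simp only [Set.mem_Icc, Set.mem_insert_iff]
      omega
    have hcongr : Set.BijOn (fun c : ℕ × ℕ => if (c.1, c.2) = (i, μ.rowLen i) then μ.card + 1
        else T.entry c.1 c.2) {c | c ∈ μ} (Set.Icc 1 μ.card) := by
      refine T.bijOn.congr fun c hc => ?_
      have hne : (c.1, c.2) ≠ (i, μ.rowLen i) := by
        rintro heq
        exact μ.mk_rowLen_notMem i (heq ▸ hc)
      simp only [if_neg hne]
    have hins := hcongr.insert (a := (i, μ.rowLen i)) (by simp)
    rw [hset, hIcc]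
    simpa using hins

theorem entry_extend (T : YTableau μ) (i : ℕ) (h : μ.Addable i) (a b : ℕ) :
    (T.extend i h).entry a b =
      if (a, b) = (i, μ.rowLen i) then μ.card + 1 else T.entry a b := rfl

theorem IsStandard.extend {T : YTableau μ} (hT : T.IsStandard) (i : ℕ) (h : μ.Addable i) :
    (T.extend i h).IsStandard := by
  have key : ∀ {a b c d : ℕ}, a ≤ c → b ≤ d → (a, b) ≠ (c, d) → (c, d) ∈ μ.addCell i h →
      (T.extend i h).entry a b < (T.extend i h).entry c d := by
    intro a b c d hac hbd hne hmem
    have hab : (a, b) ∈ μ := by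
      rcases mem_addCell.1 hmem with heq | hmem
      · rcases mem_addCell.1 ((μ.addCell i h).up_left_mem hac hbd hmem) with heq' | hmem'
        · exact absurd (heq'.trans heq.symm) hne
        · exact hmem'
      · exact μ.up_left_mem hac hbd hmem
    have hab' : (a, b) ≠ (i, μ.rowLen i) := by
      intro heq
      exact μ.mk_rowLen_notMem i (heq ▸ hab)
    rw [entry_extend, entry_extend, if_neg hab']
    split_ifs with hcd
    · exact Nat.lt_succ_of_le (T.entry_le_card a b)
    · exact hT.entry_lt hac hbd hne ((mem_addCell.1 hmem).resolve_left hcd)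
  exact ⟨fun a b d hbd hmem => key le_rfl hbd.le (by simp [hbd.ne]) hmem,
    fun a c b hac hmem => key hac.le le_rfl (by simp [hac.ne]) hmem⟩

/-- The cell with the largest entry has nothing to its right or below, so it can be erased; this is
the inverse of `extend`. -/
theorem exists_extend {T : YTableau μ} (hT : T.IsStandard) {m : ℕ} (hm : μ.card = m + 1) :
    ∃ (ν : YoungDiagram) (U : YTableau ν) (i : ℕ) (h : ν.Addable i), U.IsStandard ∧ ν.card = m ∧
      (⟨ν.addCell i h, U.extend i h⟩ : Σ μ : YoungDiagram, YTableau μ) = ⟨μ, T⟩ := by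
  obtain ⟨⟨i, j⟩, hc, hcm⟩ := T.bijOn.surjOn (show m + 1 ∈ Set.Icc 1 μ.card by simp [hm])
  simp only [Set.mem_ofPred_eq] at hc hcm
  have hmax : ∀ {a b : ℕ}, (a, b) ∈ μ → i ≤ a → j ≤ b → (a, b) = (i, j) := by
    intro a b hab hia hjb
    by_contra hne
    have h1 := hT.entry_lt hia hjb (Ne.symm hne) hab
    have h2 := T.entry_le_card a b
    omega
  let ν : YoungDiagram :=
    { cells := μ.cells.erase (i, j)
      isLowerSet := by
        rintro ⟨a, b⟩ ⟨c, d⟩ ⟨hca, hdb⟩ hab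
        simp only [Finset.coe_erase, Set.mem_sdiff, Finset.mem_coe, mem_cells,
          Set.mem_singleton_iff] at hab ⊢
        refine ⟨μ.up_left_mem hca hdb hab.1, ?_⟩
        rintro heq
        obtain ⟨rfl, rfl⟩ := Prod.mk.inj heq
        exact hab.2 (hmax hab.1 hca hdb) }
  have hν : ∀ {c : ℕ × ℕ}, c ∈ ν ↔ c ≠ (i, j) ∧ c ∈ μ := by
    intro c
    rw [← mem_cells, Finset.mem_erase, mem_cells]
  have hcard : ν.card = m := by
    have := Finset.card_erase_of_mem ((mem_cells _).2 hc)
    have h2 : μ.cells.card = m + 1 := hm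
    change (μ.cells.erase (i, j)).card = m
    omega
  have hrow : ν.rowLen i = j := by
    refine rowLen_eq_of_forall fun b => ?_
    rw [hν]
    refine ⟨fun ⟨hne, hb⟩ => ?_, fun hb => ⟨by simp [hb.ne], μ.up_left_mem le_rfl hb.le hc⟩⟩
    by_contra hle
    exact hne (hmax hb le_rfl (not_lt.1 hle))
  have hadd : ν.Addable i := by
    intro i' hi'
    rw [hrow, ← mem_iff_lt_rowLen, hν]
    exact ⟨by simp [hi'.ne], μ.up_left_mem hi'.le le_rfl hc⟩
  let U : YTableau ν :=
    { entry := fun a b => if (a, b) = (i, j) then 0 else T.entry a b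
      zeros := by
        intro a b hab
        split_ifs with heq
        · rfl
        · exact T.zeros a b fun hmem => hab (hν.2 ⟨heq, hmem⟩)
      bijOn := by
        have hsub := T.bijOn.sdiff_singleton (a := (i, j)) hc
        have hs : {c | c ∈ ν} = {c | c ∈ μ} \ {(i, j)} := by
          ext c
          simp only [Set.mem_ofPred_eq, Set.mem_sdiff, Set.mem_singleton_iff]
          rw [hν, and_comm]
        have hIcc : Set.Icc 1 ν.card = Set.Icc 1 μ.card \ {T.entry i j} := by
          ext x
          simp only [Set.mem_Icc, Set.mem_sdiff, Set.mem_singleton_iff]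
          omega
        rw [hs, hIcc]
        refine hsub.congr fun c hc => ?_
        have hne : (c.1, c.2) ≠ (i, j) := fun heq => hc.2 heq
        simp only [if_neg hne] }
  refine ⟨ν, U, i, hadd, ?_, hcard, ?_⟩
  · have key : ∀ {a b c d : ℕ}, a ≤ c → b ≤ d → (a, b) ≠ (c, d) → (c, d) ∈ ν →
        U.entry a b < U.entry c d := by
      intro a b c d hac hbd hne hmem
      change (if (a, b) = (i, j) then 0 else T.entry a b) <
        if (c, d) = (i, j) then 0 else T.entry c d
      have hmem' := hν.1 hmem
      rw [if_neg (hν.1 (ν.up_left_mem hac hbd hmem)).1, if_neg hmem'.1]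
      exact hT.entry_lt hac hbd hne hmem'.2
    exact ⟨fun a b d hbd hmem => key le_rfl hbd.le (by simp [hbd.ne]) hmem,
      fun a c b hac hmem => key hac.le le_rfl (by simp [hac.ne]) hmem⟩
  · refine sigma_ext ?_
    funext a b
    change (U.extend i hadd).entry a b = T.entry a b
    rw [entry_extend, hrow, hcard]
    change (if (a, b) = (i, j) then m + 1 else if (a, b) = (i, j) then 0 else T.entry a b) = _
    split_ifs with heq
    · obtain ⟨rfl, rfl⟩ := Prod.mk.inj heq
      exact hcm.symm
    · rfl

/-- Replace every entry `x` by `m + 1 - x`. -/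
def complement (T : YTableau μ) : YTableau μ where
  -- The value `0` marks the outside of the diagram and must be kept.
  entry a b := if T.entry a b = 0 then 0 else μ.card + 1 - T.entry a b
  zeros a b hab := by simp [T.zeros a b hab]
  bijOn := by
    have hc : Set.BijOn (fun x => μ.card + 1 - x) (Set.Icc 1 μ.card) (Set.Icc 1 μ.card) := by
      refine ⟨fun x hx => ?_, fun x hx y hy hxy => ?_, fun y hy => ⟨μ.card + 1 - y, ?_, ?_⟩⟩
      all_goals simp only [Set.mem_Icc] at *; omega
    refine (hc.comp T.bijOn).congr fun c hc => ?_
    have hne : T.entry c.1 c.2 ≠ 0 := T.mem_iff_entry_ne_zero.1 hc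
    simp [hne]

theorem entry_complement (T : YTableau μ) (a b : ℕ) : T.complement.entry a b =
    if T.entry a b = 0 then 0 else μ.card + 1 - T.entry a b := rfl

theorem complement_complement (T : YTableau μ) : T.complement.complement = T := by
  ext a b
  have h := T.entry_le_card a b
  rw [entry_complement, entry_complement]
  split_ifs <;> omega

theorem entry_complement_lt {T : YTableau μ} {a b c d : ℕ} (hcd : T.entry c d ≠ 0)
    (h : T.entry c d < T.entry a b) : T.complement.entry a b < T.complement.entry c d := by
  have h1 := T.entry_le_card a b
  rw [entry_complement, entry_complement, if_neg hcd, if_neg (by omega)]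
  omega

theorem isReverseStandard_complement {T : YTableau μ} :
    T.complement.IsReverseStandard ↔ T.IsStandard := by
  have hpos : ∀ (U : YTableau μ) {i j a b : ℕ}, (i, j) ∈ μ → a ≤ i → b ≤ j → U.entry a b ≠ 0 :=
    fun U _ _ _ _ h ha hb => U.mem_iff_entry_ne_zero.1 (μ.up_left_mem ha hb h)
  constructor
  · intro hT
    rw [← T.complement_complement]
    exact ⟨fun i j₁ j₂ hj h => entry_complement_lt (hpos _ h le_rfl le_rfl) (hT.1 i j₁ j₂ hj h),
      fun i₁ i₂ j hi h => entry_complement_lt (hpos _ h le_rfl le_rfl) (hT.2 i₁ i₂ j hi h)⟩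
  · intro hT
    exact ⟨fun i j₁ j₂ hj h => entry_complement_lt (hpos _ h le_rfl hj.le) (hT.1 i j₁ j₂ hj h),
      fun i₁ i₂ j hi h => entry_complement_lt (hpos _ h hi.le le_rfl) (hT.2 i₁ i₂ j hi h)⟩

end YTableau

/-! ### Counts as sums over standard tableaux, and their recursion. -/

theorem sum_rowLens (μ : YoungDiagram) : μ.rowLens.sum = μ.card := by
  have h0 : μ.rowLen (μ.colLen 0) = 0 := by
    rw [← rowLens_length_le_iff, length_rowLens]
  rw [card_eq_sum_rowLen h0, rowLens]
  rfl

/-- Complementing entries exchanges standard and reverse standard tableaux without changing the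
shape. -/
theorem ncard_almostEvenTableaux (k m : ℕ) :
    (AlmostEvenTableaux k m).ncard = (SYTOdd k (if Odd m then 1 else 2) m).ncard := by
  refine Set.ncard_congr (fun T _ => ⟨T.1, T.2.complement⟩) ?_ ?_ ?_
  · rintro ⟨μ, T⟩ ⟨h1, h2, h3, h4⟩
    refine ⟨?_, h2, h3, ?_⟩
    · rw [← T.complement_complement] at h1
      exact YTableau.isReverseStandard_complement.1 h1
    · simp only [AlmostEven, sum_rowLens] at h2 h4
      rw [h2] at h4
      split_ifs with hm
      · exact (h4.resolve_right fun h => Nat.not_even_iff_odd.2 hm h.1).2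
      · exact (h4.resolve_left fun h => hm h.1).2
  · rintro ⟨μ, T⟩ ⟨ν, U⟩ _ _ h
    obtain ⟨rfl, h⟩ := Sigma.mk.inj h
    rw [← T.complement_complement, eq_of_heq h, U.complement_complement]
  · rintro ⟨μ, T⟩ ⟨h1, h2, h3, h4⟩
    refine ⟨⟨μ, T.complement⟩, ⟨YTableau.isReverseStandard_complement.2 h1, h2, h3, ?_⟩, ?_⟩
    · simp only [AlmostEven, sum_rowLens] at h2 h4 ⊢
      rw [h2]
      split_ifs at h4 with hm
      · exact Or.inl ⟨hm, h4⟩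
      · exact Or.inr ⟨Nat.not_odd_iff_even.1 hm, h4⟩
    · simp [T.complement_complement]

/-- The standard tableaux with `m` cells and at most `k` rows. -/
noncomputable def standardTableaux (k m : ℕ) : Finset (Σ μ : YoungDiagram, YTableau μ) :=
  Set.Finite.toFinset (s := {T | T.2.IsStandard ∧ T.1.card = m ∧ T.1.rowLen k = 0})
    ((finite_YTableau m).subset fun _ h => h.2.1)

theorem mem_standardTableaux {k m : ℕ} {T : Σ μ : YoungDiagram, YTableau μ} :
    T ∈ standardTableaux k m ↔ T.2.IsStandard ∧ T.1.card = m ∧ T.1.rowLen k = 0 := by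
  simp [standardTableaux]

theorem ncard_SYTOdd (k t m : ℕ) : (SYTOdd k t m).ncard =
    ∑ T ∈ standardTableaux k m, if oddCount k T.1.rowLen = t then 1 else 0 := by
  classical
  rw [← Finset.card_filter, ← Set.ncard_coe_finset]
  congr 1
  ext T
  simp only [SYTOdd, Set.mem_ofPred_eq, Finset.coe_filter, mem_standardTableaux,
    rowLens_length_le_iff, and_assoc]
  refine and_congr_right fun _ => and_congr_right fun _ => and_congr_right fun h => ?_
  rw [numOdd_rowLens h]

theorem SYTOdd_eq_empty {k t m : ℕ} (h : m % 2 ≠ t % 2) : SYTOdd k t m = ∅ := by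
  refine Set.eq_empty_of_forall_notMem fun T ⟨_, h2, h3, h4⟩ => h ?_
  rw [rowLens_length_le_iff] at h3
  rw [← h4, numOdd_rowLens h3, oddCount_mod_two h3, h2]

theorem sum_standardTableaux_zero {A : Type*} [AddCommMonoid A] (k : ℕ) (F : (ℕ → ℕ) → A) :
    ∑ T ∈ standardTableaux k 0, F T.1.rowLen = F 0 := by
  let T₀ : Σ μ : YoungDiagram, YTableau μ := ⟨⊥, ⟨fun _ _ => 0, fun _ _ _ => rfl, by
    have h1 : {c : ℕ × ℕ | c ∈ (⊥ : YoungDiagram)} = ∅ := by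
      ext c
      simp
    rw [h1]
    simp [YoungDiagram.card]⟩⟩
  have hrow : T₀.1.rowLen = 0 := by
    funext i
    exact rowLen_eq_of_forall fun j => by simp [T₀]
  have hs : standardTableaux k 0 = {T₀} := by
    ext T
    rw [mem_standardTableaux, Finset.mem_singleton]
    constructor
    · rintro ⟨_, h2, _⟩
      refine YTableau.sigma_ext ?_
      funext i j
      change _ = 0
      have := T.2.entry_le_card i j
      omega
    · rintro rfl
      refine ⟨⟨fun i j₁ j₂ _ h => ?_, fun i₁ i₂ j _ h => ?_⟩, ?_, by rw [hrow]; rfl⟩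
      · exact absurd h (notMem_bot _)
      · exact absurd h (notMem_bot _)
      · simp [T₀, YoungDiagram.card]
  rw [hs, Finset.sum_singleton, hrow]

-- Removing the largest entry is a bijection onto pairs of a smaller tableau and an addable row.
open Classical in
theorem sum_standardTableaux_succ {A : Type*} [AddCommMonoid A] (k m : ℕ) (F : (ℕ → ℕ) → A) :
    ∑ T ∈ standardTableaux k (m + 1), F T.1.rowLen =
      ∑ T ∈ standardTableaux k m, ∑ i ∈ (Finset.range k).filter T.1.Addable,
        F (Function.update T.1.rowLen i (T.1.rowLen i + 1)) := by
  rw [Finset.sum_sigma']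
  symm
  refine Finset.sum_bij (fun p hp => ⟨p.1.1.addCell p.2
    (Finset.mem_filter.1 (Finset.mem_sigma.1 hp).2).2, p.1.2.extend p.2 _⟩) ?_ ?_ ?_ ?_
  · rintro ⟨⟨μ, T⟩, i⟩ hp
    simp only [Finset.mem_sigma, mem_standardTableaux, Finset.mem_filter, Finset.mem_range] at hp
    obtain ⟨⟨h1, h2, h3⟩, h4, h5⟩ := hp
    rw [mem_standardTableaux]
    refine ⟨h1.extend i h5, by rw [card_addCell, h2], ?_⟩
    simp only [rowLen_addCell]
    rw [Function.update_of_ne h4.ne', h3]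
  · rintro ⟨⟨μ, T⟩, i⟩ hp ⟨⟨ν, U⟩, j⟩ hq h
    simp only [Finset.mem_sigma, mem_standardTableaux, Finset.mem_filter, Finset.mem_range] at hp hq
    have hcard : μ.card = ν.card := hp.1.2.1.trans hq.1.2.1.symm
    have hentry : ∀ a b, (if (a, b) = (i, μ.rowLen i) then μ.card + 1 else T.entry a b) =
        if (a, b) = (j, ν.rowLen j) then ν.card + 1 else U.entry a b := by
      intro a b
      have := congrArg (fun T : Σ μ : YoungDiagram, YTableau μ => T.2.entry a b) h
      exact this
    have hc : (i, μ.rowLen i) = (j, ν.rowLen j) := by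
      by_contra hne
      have h1 := hentry i (μ.rowLen i)
      rw [if_pos rfl, if_neg hne] at h1
      have h2 := U.entry_le_card i (μ.rowLen i)
      omega
    have hTU : (⟨μ, T⟩ : Σ μ : YoungDiagram, YTableau μ) = ⟨ν, U⟩ := by
      refine YTableau.sigma_ext ?_
      funext a b
      have h1 := hentry a b
      rw [← hc] at h1
      by_cases hab : (a, b) = (i, μ.rowLen i)
      · have h3 := T.zeros a b (hab ▸ μ.mk_rowLen_notMem i)
        have h4 := U.zeros a b (hab.trans hc ▸ ν.mk_rowLen_notMem j)
        exact h3.trans h4.symm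
      · rwa [if_neg hab, if_neg hab] at h1
    rw [hTU, (Prod.mk.inj hc).1]
  · rintro ⟨μ, T⟩ hT
    rw [mem_standardTableaux] at hT
    obtain ⟨ν, U, i, h, hU, hcard, heq⟩ := YTableau.exists_extend hT.1 hT.2.1
    have hrow : μ.rowLen k = Function.update ν.rowLen i (ν.rowLen i + 1) k := by
      rw [← rowLen_addCell (h := h)]
      exact congrArg (fun T : Σ μ : YoungDiagram, YTableau μ => T.1.rowLen k) heq.symm
    have h0 : Function.update ν.rowLen i (ν.rowLen i + 1) k = 0 := hrow.symm.trans hT.2.2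
    have hki : k ≠ i := by
      rintro rfl
      simp at h0
    rw [Function.update_of_ne hki] at h0
    have hik : i < k := by
      by_contra hle
      have := h k (lt_of_le_of_ne (not_lt.1 hle) hki)
      omega
    refine ⟨⟨⟨ν, U⟩, i⟩, ?_, heq⟩
    simp only [Finset.mem_sigma, mem_standardTableaux, Finset.mem_filter, Finset.mem_range]
    exact ⟨⟨hU, hcard, h0⟩, hik, h⟩
  · rintro ⟨⟨μ, T⟩, i⟩ hp
    simp only [rowLen_addCell]

/-- A weight on shapes that vanishes where a cell cannot be added, and is multiplied by `p` when
summed over all ways to lengthen a row, has total `p ^ m * F 0` over the tableaux with `m` cells. -/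
theorem sum_standardTableaux_eq_pow {A : Type*} [CommRing A] (k : ℕ) (F : (ℕ → ℕ) → A) (p : A)
    (hzero : ∀ l : ℕ → ℕ, ∀ i, i + 1 < k → l i = l (i + 1) →
      F (Function.update l (i + 1) (l (i + 1) + 1)) = 0)
    (hsum : ∀ l : ℕ → ℕ, ∑ i ∈ Finset.range k, F (Function.update l i (l i + 1)) = p * F l)
    (m : ℕ) : ∑ T ∈ standardTableaux k m, F T.1.rowLen = p ^ m * F 0 := by
  classical
  induction m with
  | zero => rw [sum_standardTableaux_zero, pow_zero, one_mul]
  | succ m ih =>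
    rw [sum_standardTableaux_succ, pow_succ', mul_assoc, ← ih, Finset.mul_sum]
    refine Finset.sum_congr rfl fun T _ => ?_
    rw [← hsum, Finset.sum_filter_of_ne]
    intro i hi hne
    by_contra hadd
    rcases i with _ | i
    · exact hadd fun i' h => absurd h (Nat.not_lt_zero _)
    -- Row lengths decrease weakly, so a row that is not addable is as long as the row just above
    -- it; there the weight vanishes, and the sum may run over all rows.
    · refine hne (hzero _ i (Finset.mem_range.1 hi) ?_)
      have h1 := T.1.rowLen_anti i (i + 1) i.le_succ
      by_contra hne'
      exact hadd fun i' h => lt_of_lt_of_le (lt_of_le_of_ne h1 (Ne.symm hne'))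
        (T.1.rowLen_anti i' i (Nat.lt_succ_iff.1 h))

/-! ### Constant terms of Laurent polynomials. -/

open scoped LaurentPolynomial

/-- The constant term of a Laurent polynomial. -/
noncomputable def constTerm (M : Type*) [AddZeroClass M] : AddMonoidAlgebra ℚ M →ₗ[ℚ] ℚ where
  toFun f := f.coeff 0
  map_add' f g := by simp
  map_smul' c f := by simp

theorem constTerm_single {M : Type*} [AddZeroClass M] [DecidableEq M] (i : M) (c : ℚ) :
    constTerm M (AddMonoidAlgebra.single i c) = if i = 0 then c else 0 :=
  Finsupp.single_apply

/-- The map of Laurent polynomials induced by a map of exponents. -/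
noncomputable def monomialMap (u : ℤ →+ ℤ × ℤ) :
    ℚ[T;T⁻¹] →ₐ[ℚ] AddMonoidAlgebra ℚ (ℤ × ℤ) :=
  AddMonoidAlgebra.mapDomainAlgHom ℚ ℚ u

theorem monomialMap_single (u : ℤ →+ ℤ × ℤ) (i : ℤ) (c : ℚ) :
    monomialMap u (AddMonoidAlgebra.single i c) = AddMonoidAlgebra.single (u i) c :=
  AddMonoidAlgebra.mapDomain_single

/-- Fubini for constant terms: by `huv` the two substituted monomials are multiplicatively
independent. -/
theorem constTerm_mul_monomialMap (u v : ℤ →+ ℤ × ℤ) (huv : ∀ i j, u i + v j = 0 → i = 0 ∧ j = 0)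
    (f g : ℚ[T;T⁻¹]) : constTerm _ (monomialMap u f * monomialMap v g) =
      constTerm _ f * constTerm _ g := by
  induction f using AddMonoidAlgebra.induction_linear with
  | zero => simp
  | add f f' hf hf' => simp only [map_add, add_mul, hf, hf']
  | single i c =>
    induction g using AddMonoidAlgebra.induction_linear with
    | zero => simp
    | add g g' hg hg' => simp only [map_add, mul_add, hg, hg']
    | single j d =>
      rw [monomialMap_single, monomialMap_single, AddMonoidAlgebra.single_mul_single,
        constTerm_single, constTerm_single, constTerm_single]
      by_cases h : u i + v j = 0
      · obtain ⟨rfl, rfl⟩ := huv i j h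
        simp
      · rw [if_neg h]
        split_ifs with hi hj
        · subst hi hj
          simp at h
        all_goals simp

/-- The Laurent polynomial `T + T⁻¹`. -/
noncomputable def tPlusInv : ℚ[T;T⁻¹] := LaurentPolynomial.T 1 + LaurentPolynomial.T (-1)

theorem constTerm_T (i : ℤ) :
    constTerm ℤ (LaurentPolynomial.T i) = if i = 0 then 1 else 0 := constTerm_single i 1

theorem constTerm_tPlusInv_pow (n : ℕ) :
    constTerm ℤ (tPlusInv ^ n) = if Even n then (n.choose (n / 2) : ℚ) else 0 := by
  have hterm : ∀ k ∈ Finset.range (n + 1),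
      constTerm ℤ ((LaurentPolynomial.T 1 : ℚ[T;T⁻¹]) ^ k * LaurentPolynomial.T (-1) ^ (n - k) *
        (n.choose k : ℚ[T;T⁻¹])) = if n = 2 * k then (n.choose k : ℚ) else 0 := by
    intro k hk
    have hk' : k ≤ n := Nat.lt_succ_iff.1 (Finset.mem_range.1 hk)
    rw [LaurentPolynomial.T_pow, LaurentPolynomial.T_pow, ← LaurentPolynomial.T_add, mul_comm,
      ← nsmul_eq_mul, map_nsmul, constTerm_T]
    have hiff : (k : ℤ) * 1 + ((n - k : ℕ) : ℤ) * -1 = 0 ↔ n = 2 * k := by omega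
    simp only [hiff]
    split_ifs <;> simp
  rw [tPlusInv, (Commute.all _ _).add_pow, map_sum, Finset.sum_congr rfl hterm]
  split_ifs with hn
  · obtain ⟨r, rfl⟩ := hn
    rw [Finset.sum_eq_single ((r + r) / 2)]
    · rw [if_pos (by omega)]
    · intro k _ hk
      rw [if_neg (by omega)]
    · intro h
      exact absurd (Finset.mem_range.2 (by omega)) h
  · refine Finset.sum_eq_zero fun k _ => ?_
    rw [if_neg]
    rintro rfl
    exact hn (even_two_mul k)

/-- Since `4 - (T + T⁻¹) ^ 2 = -(T - T⁻¹) ^ 2` is the Weyl density of `SU(2)`, these are the even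
moments of its trace, up to the order `2` of the Weyl group. -/
theorem constTerm_semicircle_even (n : ℕ) :
    constTerm ℤ ((4 - tPlusInv ^ 2) * tPlusInv ^ (2 * n)) = 2 * (catalan n : ℚ) := by
  have hexp : (4 - tPlusInv ^ 2) * tPlusInv ^ (2 * n) =
      (4 : ℚ) • tPlusInv ^ (2 * n) - tPlusInv ^ (2 * (n + 1)) := by
    rw [Algebra.smul_def, map_ofNat]
    ring
  have h1 : ((2 * n).choose n : ℚ) = (n + 1) * catalan n := by
    exact_mod_cast (succ_mul_catalan_eq_centralBinom n).symm
  have h2 : ((n : ℚ) + 1) * (2 * (n + 1)).choose (n + 1) = 2 * (2 * n + 1) * (2 * n).choose n := by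
    exact_mod_cast Nat.succ_mul_centralBinom_succ n
  have hpos : (n : ℚ) + 1 ≠ 0 := by positivity
  rw [hexp, map_sub, map_smul, constTerm_tPlusInv_pow, constTerm_tPlusInv_pow,
    if_pos (even_two_mul _), if_pos (even_two_mul _), Nat.mul_div_cancel_left _ two_pos,
    Nat.mul_div_cancel_left _ two_pos, smul_eq_mul]
  apply mul_left_cancel₀ hpos
  rw [mul_sub, h2, h1]
  ring

theorem constTerm_semicircle_odd (n : ℕ) :
    constTerm ℤ ((4 - tPlusInv ^ 2) * tPlusInv ^ (2 * n + 1)) = 0 := by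
  have hexp : (4 - tPlusInv ^ 2) * tPlusInv ^ (2 * n + 1) =
      (4 : ℚ) • tPlusInv ^ (2 * n + 1) - tPlusInv ^ (2 * (n + 1) + 1) := by
    rw [Algebra.smul_def, map_ofNat]
    ring
  have hodd : ∀ n : ℕ, ¬ Even (2 * n + 1) := fun n => by simp
  rw [hexp, map_sub, map_smul, constTerm_tPlusInv_pow, constTerm_tPlusInv_pow,
    if_neg (hodd _), if_neg (hodd _)]
  simp

/-! ### Characters of `SU(2)` as Chebyshev polynomials. -/

section ChebU

variable {A B : Type*} [CommRing A] [Algebra ℚ A] [CommRing B] [Algebra ℚ B]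

/-- `chebU (x + x⁻¹) n = (x ^ n - x ^ (-n)) / (x - x⁻¹)`. -/
noncomputable def chebU (z : A) (n : ℤ) : A :=
  Polynomial.aeval z (Polynomial.Chebyshev.S ℚ (n - 1))

theorem chebU_zero (z : A) : chebU z 0 = 0 := by simp [chebU]

theorem chebU_one (z : A) : chebU z 1 = 1 := by simp [chebU]

theorem chebU_rec (z : A) (n : ℤ) : z * chebU z n = chebU z (n + 1) + chebU z (n - 1) := by
  have h := congrArg (Polynomial.aeval z) (Polynomial.Chebyshev.S_add_one ℚ (n - 1))
  simp only [map_sub, map_mul, Polynomial.aeval_X] at h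
  rw [chebU, chebU, chebU, show n + 1 - 1 = n - 1 + 1 by ring, h]
  ring

theorem chebU_two (z : A) : chebU z 2 = z := by
  have h := chebU_rec z 1
  rw [chebU_one, show (1 : ℤ) + 1 = 2 by norm_num, sub_self, chebU_zero] at h
  linear_combination -h

theorem chebU_three (z : A) : chebU z 3 = z ^ 2 - 1 := by
  have h := chebU_rec z 2
  rw [chebU_two, show (2 : ℤ) + 1 = 3 by norm_num, show (2 : ℤ) - 1 = 1 by norm_num,
    chebU_one] at h
  linear_combination -h

theorem chebU_four (z : A) : chebU z 4 = z ^ 3 - 2 * z := by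
  have h := chebU_rec z 3
  rw [chebU_three, show (3 : ℤ) + 1 = 4 by norm_num, show (3 : ℤ) - 1 = 2 by norm_num,
    chebU_two] at h
  linear_combination -h

theorem map_chebU (f : A →ₐ[ℚ] B) (z : A) (n : ℤ) : f (chebU z n) = chebU (f z) n := by
  rw [chebU, chebU, Polynomial.aeval_algHom_apply]

end ChebU

theorem chebU_tPlusInv_add_two (n : ℕ) : chebU tPlusInv (n + 2 : ℤ) =
    chebU tPlusInv n + LaurentPolynomial.T (n + 1) + LaurentPolynomial.T (-(n + 1)) := by
  induction n using Nat.strong_induction_on with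
  | _ n ih =>
    match n, ih with
    | 0, _ =>
      simp only [Nat.cast_zero, zero_add, chebU_two, chebU_zero]
      rfl
    | 1, _ =>
      have h : tPlusInv ^ 2 = LaurentPolynomial.T 2 + 2 + LaurentPolynomial.T (-2) := by
        rw [tPlusInv, add_sq, LaurentPolynomial.T_pow, LaurentPolynomial.T_pow, mul_assoc,
          ← LaurentPolynomial.T_add]
        simp
      rw [Nat.cast_one, show (1 : ℤ) + 2 = 3 by norm_num, show (1 : ℤ) + 1 = 2 by norm_num,
        chebU_three, chebU_one, h]
      ring
    | n + 2, ih =>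
      have h0 := ih n (by omega)
      have h1 := ih (n + 1) (by omega)
      have r1 := chebU_rec tPlusInv ((n : ℤ) + 3)
      have r2 := chebU_rec tPlusInv ((n : ℤ) + 1)
      have t1 : tPlusInv * LaurentPolynomial.T (n + 2) =
          LaurentPolynomial.T (n + 3) + LaurentPolynomial.T (n + 1) := by
        rw [tPlusInv, add_mul, ← LaurentPolynomial.T_add, ← LaurentPolynomial.T_add]
        ring_nf
      have t2 : tPlusInv * LaurentPolynomial.T (-(n + 2)) =
          LaurentPolynomial.T (-(n + 3)) + LaurentPolynomial.T (-(n + 1)) := by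
        rw [tPlusInv, add_mul, ← LaurentPolynomial.T_add, ← LaurentPolynomial.T_add]
        ring_nf
      push_cast at *
      simp only [show (n : ℤ) + 3 + 1 = n + 2 + 2 by ring, show (n : ℤ) + 3 - 1 = n + 2 by ring,
        show (n : ℤ) + 1 + 1 = n + 2 by ring, show (n : ℤ) + 1 - 1 = n by ring,
        show (n : ℤ) + 1 + 2 = n + 3 by ring, show (n : ℤ) + 2 + 1 = n + 3 by ring] at *
      linear_combination -r1 + r2 - h0 + tPlusInv * h1 + t1 + t2

/-- The `n`-th polynomial is `T ^ (n-1) + T ^ (n-3) + ⋯ + T ^ (1-n)`, which contains `1` exactly for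
odd `n`. -/
theorem constTerm_chebU {n : ℤ} (hn : 0 ≤ n) :
    constTerm ℤ (chebU tPlusInv n) = ((n % 2 : ℤ) : ℚ) := by
  lift n to ℕ using hn
  induction n using Nat.twoStepInduction with
  | zero => simp [chebU_zero]
  | one =>
    rw [Nat.cast_one, chebU_one, ← LaurentPolynomial.T_zero, constTerm_T]
    simp
  | more n ih _ =>
    rw [Nat.cast_add, Nat.cast_two, chebU_tPlusInv_add_two, map_add, map_add, ih, constTerm_T,
      constTerm_T, if_neg (by omega), if_neg (by omega), Int.add_emod_right]
    ring

/-! ### Two variables and the double cover of `SO(4)`. -/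

/-- The ring of Laurent polynomials in two variables `a, b`. -/
abbrev Laurent₂ := AddMonoidAlgebra ℚ (ℤ × ℤ)

/-- `x + x⁻¹` for `x = a b`. -/
noncomputable def zVar : Laurent₂ :=
  monomialMap ((AddMonoidHom.id ℤ).prod (AddMonoidHom.id ℤ)) tPlusInv

/-- `y + y⁻¹` for `y = a b⁻¹`. -/
noncomputable def wVar : Laurent₂ :=
  monomialMap ((AddMonoidHom.id ℤ).prod (-AddMonoidHom.id ℤ)) tPlusInv

/-- `a + a⁻¹`. -/
noncomputable def aVar : Laurent₂ := monomialMap (AddMonoidHom.inl ℤ ℤ) tPlusInv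

/-- `b + b⁻¹`. -/
noncomputable def bVar : Laurent₂ := monomialMap (AddMonoidHom.inr ℤ ℤ) tPlusInv

theorem zVar_add_wVar : zVar + wVar = aVar * bVar := by
  simp only [zVar, wVar, aVar, bVar, tPlusInv, LaurentPolynomial.T, map_add, monomialMap_single,
    mul_add, add_mul, AddMonoidAlgebra.single_mul_single, AddMonoidHom.prod_apply,
    AddMonoidHom.id_apply, AddMonoidHom.neg_apply, AddMonoidHom.inl_apply, AddMonoidHom.inr_apply,
    Prod.mk_add_mk, add_zero, zero_add, mul_one, neg_neg]
  abel

theorem zVar_mul_wVar : zVar * wVar = aVar ^ 2 + bVar ^ 2 - 4 := by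
  have h4 : (4 : Laurent₂) = AddMonoidAlgebra.single (0, 0) 1 + AddMonoidAlgebra.single (0, 0) 1 +
      AddMonoidAlgebra.single (0, 0) 1 + AddMonoidAlgebra.single (0, 0) 1 := by
    have h1 : (AddMonoidAlgebra.single (0, 0) 1 : Laurent₂) = 1 := rfl
    rw [h1]
    norm_num
  rw [h4]
  simp only [zVar, wVar, aVar, bVar, tPlusInv, LaurentPolynomial.T, map_add, monomialMap_single,
    sq, mul_add, add_mul, AddMonoidAlgebra.single_mul_single, AddMonoidHom.prod_apply,
    AddMonoidHom.id_apply, AddMonoidHom.neg_apply, AddMonoidHom.inl_apply, AddMonoidHom.inr_apply,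
    Prod.mk_add_mk, add_zero, mul_one, neg_neg, add_neg_cancel, neg_add_cancel]
  abel

/-- The monomials `a b` and `a b⁻¹` are independent, so constant terms in `x, y` may be taken in `a,
b`. -/
theorem constTerm_chebU_mul_chebU {m n : ℤ} (hm : 0 ≤ m) (hn : 0 ≤ n) :
    constTerm _ (chebU zVar m * chebU wVar n) = ((m % 2 : ℤ) : ℚ) * ((n % 2 : ℤ) : ℚ) := by
  rw [zVar, wVar, ← map_chebU, ← map_chebU, constTerm_mul_monomialMap, constTerm_chebU hm,
    constTerm_chebU hn]
  intro i j h
  simp only [AddMonoidHom.prod_apply, AddMonoidHom.id_apply, AddMonoidHom.neg_apply,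
    Prod.mk_add_mk, Prod.mk_eq_zero] at h
  omega

theorem constTerm_aVar_bVar (f g : Polynomial ℚ) :
    constTerm _ (Polynomial.aeval aVar f * Polynomial.aeval bVar g) =
      constTerm ℤ (Polynomial.aeval tPlusInv f) * constTerm ℤ (Polynomial.aeval tPlusInv g) := by
  rw [aVar, bVar, Polynomial.aeval_algHom_apply, Polynomial.aeval_algHom_apply,
    constTerm_mul_monomialMap]
  intro i j h
  simpa using h

/-- The moments of a semicircular variable, scaled by `2`. -/
noncomputable def semicircleMoment (n : ℕ) : ℚ := if Even n then 2 * (catalan (n / 2) : ℚ) else 0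

theorem constTerm_semicircle (n : ℕ) :
    constTerm ℤ ((4 - tPlusInv ^ 2) * tPlusInv ^ n) = semicircleMoment n := by
  rcases Nat.even_or_odd' n with ⟨r, rfl | rfl⟩
  · rw [constTerm_semicircle_even, semicircleMoment, if_pos (even_two_mul r),
      Nat.mul_div_cancel_left _ two_pos]
  · rw [constTerm_semicircle_odd, semicircleMoment, if_neg (by simp)]

theorem constTerm_semicircle_two (i j : ℕ) :
    constTerm _ ((4 - aVar ^ 2) * (4 - bVar ^ 2) * (aVar ^ i * bVar ^ j)) =
      semicircleMoment i * semicircleMoment j := by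
  have h := constTerm_aVar_bVar ((4 - Polynomial.X ^ 2) * Polynomial.X ^ i)
    ((4 - Polynomial.X ^ 2) * Polynomial.X ^ j)
  simp only [map_mul, map_sub, map_pow, Polynomial.aeval_X, map_ofNat] at h
  rw [← constTerm_semicircle, ← constTerm_semicircle, ← h]
  congr 1
  ring

/-! ### Alternants: Pieri rules, vanishing, Vandermonde values. -/

section Weights

variable {A : Type*} [CommRing A] [Algebra ℚ A]

/-- The parity of an integer as an element of a ring. -/
def parity (A : Type*) [CommRing A] (a : ℤ) : A := ((a % 2 : ℤ) : A)

theorem parity_add_one (A : Type*) [CommRing A] (a : ℤ) : parity A (a + 1) = 1 - parity A a := by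
  rw [parity, parity, eq_sub_iff_add_eq, ← Int.cast_add, show (a + 1) % 2 + a % 2 = 1 by omega,
    Int.cast_one]

theorem parity_add_two (A : Type*) [CommRing A] (a : ℤ) : parity A (a + 2) = parity A a := by
  simp [parity]

/-- Makes the constant term of each minor polynomial in the parities of the single arguments. -/
theorem parity_sub (a b : ℤ) : parity ℚ (a - b) = (parity ℚ a - parity ℚ b) ^ 2 := by
  rw [parity, parity, parity, Int.sub_emod]
  rcases Int.emod_two_eq_zero_or_one a with ha | ha <;>
    rcases Int.emod_two_eq_zero_or_one b with hb | hb <;> simp [ha, hb]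

/-- The product of two `2 × 2` minors, symmetrised in `z` and `w`. -/
noncomputable def chebPair (z w : A) (a b c d : ℤ) : A :=
  chebU z (a - b) * chebU w (c - d) + chebU w (a - b) * chebU z (c - d)

theorem chebU_pieri (z : A) (a b : ℤ) :
    chebU z (a + 1 - b) + chebU z (a - (b + 1)) = z * chebU z (a - b) := by
  rw [chebU_rec]
  ring_nf

theorem chebPair_pieri (z w : A) (a b c d : ℤ) :
    chebPair z w (a + 1) b c d + chebPair z w a (b + 1) c d + chebPair z w a b (c + 1) d +
      chebPair z w a b c (d + 1) = (z + w) * chebPair z w a b c d := by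
  simp only [chebPair]
  linear_combination chebU w (c - d) * chebU_pieri z a b + chebU z (c - d) * chebU_pieri w a b +
    chebU w (a - b) * chebU_pieri z c d + chebU z (a - b) * chebU_pieri w c d

/-- The factor is `e_2(x, x⁻¹, y, y⁻¹) = 2 + z w`. Raising both arguments of one minor leaves it
unchanged, which gives the `2`; raising one in each minor gives `z w`. -/
theorem chebPair_pieri_two (z w : A) (a b c d : ℤ) :
    chebPair z w (a + 1) (b + 1) c d + chebPair z w (a + 1) b (c + 1) d +
      chebPair z w (a + 1) b c (d + 1) + chebPair z w a (b + 1) (c + 1) d +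
      chebPair z w a (b + 1) c (d + 1) + chebPair z w a b (c + 1) (d + 1) =
        (2 + z * w) * chebPair z w a b c d := by
  simp only [chebPair, add_sub_add_right_eq_sub]
  linear_combination
    (chebU w (c + 1 - d) + chebU w (c - (d + 1))) * chebU_pieri z a b +
    (chebU z (c + 1 - d) + chebU z (c - (d + 1))) * chebU_pieri w a b +
    w * chebU w (a - b) * chebU_pieri z c d + z * chebU z (a - b) * chebU_pieri w c d

/-- The weight of a shape with at most four rows, in terms of the shifted row lengths. -/
noncomputable def weight₄ (z w : A) (a b c d : ℤ) : A :=
  -- Laplace expansion of the alternant at `x, x⁻¹, y, y⁻¹` along the rows of `x, x⁻¹`, divided by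
  -- `(x - x⁻¹) (y - y⁻¹)`.
  chebPair z w a b c d - chebPair z w a c b d + chebPair z w a d b c

theorem weight₄_pieri (z w : A) (a b c d : ℤ) :
    weight₄ z w (a + 1) b c d + weight₄ z w a (b + 1) c d + weight₄ z w a b (c + 1) d +
      weight₄ z w a b c (d + 1) = (z + w) * weight₄ z w a b c d := by
  simp only [weight₄]
  linear_combination chebPair_pieri z w a b c d - chebPair_pieri z w a c b d +
    chebPair_pieri z w a d b c

theorem weight₄_pieri_two (z w : A) (a b c d : ℤ) :
    weight₄ z w (a + 1) (b + 1) c d + weight₄ z w (a + 1) b (c + 1) d +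
      weight₄ z w (a + 1) b c (d + 1) + weight₄ z w a (b + 1) (c + 1) d +
      weight₄ z w a (b + 1) c (d + 1) + weight₄ z w a b (c + 1) (d + 1) =
        (2 + z * w) * weight₄ z w a b c d := by
  simp only [weight₄]
  linear_combination chebPair_pieri_two z w a b c d - chebPair_pieri_two z w a c b d +
    chebPair_pieri_two z w a d b c

theorem weight₄_self₁ (z w : A) (a c d : ℤ) : weight₄ z w a a c d = 0 := by
  simp only [weight₄, chebPair, sub_self, chebU_zero]
  ring

theorem weight₄_self₂ (z w : A) (a b d : ℤ) : weight₄ z w a b b d = 0 := by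
  simp only [weight₄, chebPair, sub_self, chebU_zero]
  ring

theorem weight₄_self₃ (z w : A) (a b c : ℤ) : weight₄ z w a b c c = 0 := by
  simp only [weight₄, chebPair, sub_self, chebU_zero]
  ring

/-- The Vandermonde determinant leaves `(z - w) ^ 2`, the Weyl density of `SO(4)`. -/
theorem weight₄_delta (z w : A) : weight₄ z w 3 2 1 0 = (z + w) ^ 2 - 4 * (z * w) := by
  norm_num [weight₄, chebPair, chebU_one, chebU_two, chebU_three]
  ring

/-- The weight of a shape with at most five rows, in terms of the shifted row lengths. -/
noncomputable def weight₅ (z w : A) (a b c d e : ℤ) : A :=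
  -- Expansion of the five-row alternant along the row of the additional eigenvalue `1`.
  weight₄ z w b c d e - weight₄ z w a c d e + weight₄ z w a b d e - weight₄ z w a b c e +
    weight₄ z w a b c d

theorem weight₅_pieri (z w : A) (a b c d e : ℤ) :
    weight₅ z w (a + 1) b c d e + weight₅ z w a (b + 1) c d e + weight₅ z w a b (c + 1) d e +
      weight₅ z w a b c (d + 1) e + weight₅ z w a b c d (e + 1) =
        (z + w + 1) * weight₅ z w a b c d e := by
  simp only [weight₅]
  linear_combination weight₄_pieri z w b c d e - weight₄_pieri z w a c d e +
    weight₄_pieri z w a b d e - weight₄_pieri z w a b c e + weight₄_pieri z w a b c d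

/-- With the eigenvalue `1` added, `e_2` becomes `e_2 + e_1` of the other four: in each minor,
either both raised arguments are present, or one of them is the omitted one. -/
theorem weight₅_pieri_two (z w : A) (a b c d e : ℤ) :
    weight₅ z w (a + 1) (b + 1) c d e + weight₅ z w (a + 1) b (c + 1) d e +
      weight₅ z w (a + 1) b c (d + 1) e + weight₅ z w (a + 1) b c d (e + 1) +
      weight₅ z w a (b + 1) (c + 1) d e + weight₅ z w a (b + 1) c (d + 1) e +
      weight₅ z w a (b + 1) c d (e + 1) + weight₅ z w a b (c + 1) (d + 1) e +
      weight₅ z w a b (c + 1) d (e + 1) + weight₅ z w a b c (d + 1) (e + 1) =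
        (2 + z * w + (z + w)) * weight₅ z w a b c d e := by
  simp only [weight₅]
  linear_combination weight₄_pieri_two z w b c d e - weight₄_pieri_two z w a c d e +
    weight₄_pieri_two z w a b d e - weight₄_pieri_two z w a b c e + weight₄_pieri_two z w a b c d +
    weight₄_pieri z w b c d e - weight₄_pieri z w a c d e +
    weight₄_pieri z w a b d e - weight₄_pieri z w a b c e + weight₄_pieri z w a b c d

theorem weight₅_self₁ (z w : A) (a c d e : ℤ) : weight₅ z w a a c d e = 0 := by
  simp only [weight₅, weight₄_self₁]
  ring

theorem weight₅_self₂ (z w : A) (a b d e : ℤ) : weight₅ z w a b b d e = 0 := by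
  simp only [weight₅, weight₄_self₁, weight₄_self₂]
  ring

theorem weight₅_self₃ (z w : A) (a b c e : ℤ) : weight₅ z w a b c c e = 0 := by
  simp only [weight₅, weight₄_self₂, weight₄_self₃]
  ring

theorem weight₅_self₄ (z w : A) (a b c d : ℤ) : weight₅ z w a b c d d = 0 := by
  simp only [weight₅, weight₄_self₃]
  ring

/-- The eigenvalue `1` contributes `(2 - z) (2 - w)` to the Vandermonde determinant. -/
theorem weight₅_delta (z w : A) : weight₅ z w 4 3 2 1 0 =
    (4 - 2 * (z + w) + z * w) * ((z + w) ^ 2 - 4 * (z * w)) := by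
  norm_num [weight₅, weight₄, chebPair, chebU_one, chebU_two, chebU_three, chebU_four]
  ring

/-- The weight of a shape with at most four rows belonging to the matrices of determinant `-1`. -/
noncomputable def signWeight₄ (z : A) (a b c d : ℤ) : A :=
  -- The eigenvalues are `x, x⁻¹, 1, -1`. The minor of `1, -1` is `(-1) ^ d - (-1) ^ c`, twice the
  -- difference of parities; the common factor `2` is dropped.
  chebU z (a - b) * (parity A c - parity A d) - chebU z (a - c) * (parity A b - parity A d) +
    chebU z (a - d) * (parity A b - parity A c) + chebU z (b - c) * (parity A a - parity A d) -
    chebU z (b - d) * (parity A a - parity A c) + chebU z (c - d) * (parity A a - parity A b)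

theorem signWeight₄_pieri (z : A) (a b c d : ℤ) :
    signWeight₄ z (a + 1) b c d + signWeight₄ z a (b + 1) c d + signWeight₄ z a b (c + 1) d +
      signWeight₄ z a b c (d + 1) = z * signWeight₄ z a b c d := by
  simp only [signWeight₄, parity_add_one]
  linear_combination (parity A c - parity A d) * chebU_pieri z a b -
    (parity A b - parity A d) * chebU_pieri z a c + (parity A b - parity A c) * chebU_pieri z a d +
    (parity A a - parity A d) * chebU_pieri z b c - (parity A a - parity A c) * chebU_pieri z b d +
    (parity A a - parity A b) * chebU_pieri z c d

theorem signWeight₄_self₁ (z : A) (a c d : ℤ) : signWeight₄ z a a c d = 0 := by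
  simp only [signWeight₄, sub_self, chebU_zero]
  ring

theorem signWeight₄_self₂ (z : A) (a b d : ℤ) : signWeight₄ z a b b d = 0 := by
  simp only [signWeight₄, sub_self, chebU_zero]
  ring

theorem signWeight₄_self₃ (z : A) (a b c : ℤ) : signWeight₄ z a b c c = 0 := by
  simp only [signWeight₄, sub_self, chebU_zero]
  ring

theorem signWeight₄_delta (z : A) : signWeight₄ z 3 2 1 0 = 4 - z ^ 2 := by
  norm_num [signWeight₄, parity, chebU_one, chebU_two, chebU_three]
  ring

/-- The weight of a shape with at most three rows, in terms of the shifted row lengths. -/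
noncomputable def weight₃ (z : A) (a b c : ℤ) : A :=
  -- The alternant at `x, x⁻¹, 1`, divided by `x - x⁻¹`.
  chebU z (a - b) - chebU z (a - c) + chebU z (b - c)

theorem weight₃_pieri (z : A) (a b c : ℤ) :
    weight₃ z (a + 1) b c + weight₃ z a (b + 1) c + weight₃ z a b (c + 1) =
      (z + 1) * weight₃ z a b c := by
  simp only [weight₃]
  linear_combination chebU_pieri z a b - chebU_pieri z a c + chebU_pieri z b c

end Weights

/-! ### Constant terms of minors in terms of parities. -/

section ConstantTerms

theorem constTerm_chebPair {a b c d : ℤ} (hab : b ≤ a) (hcd : d ≤ c) :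
    constTerm _ (chebPair zVar wVar a b c d) =
      2 * ((parity ℚ a - parity ℚ b) ^ 2 * (parity ℚ c - parity ℚ d) ^ 2) := by
  have h1 := constTerm_chebU_mul_chebU (sub_nonneg.2 hab) (sub_nonneg.2 hcd)
  have h2 := constTerm_chebU_mul_chebU (sub_nonneg.2 hcd) (sub_nonneg.2 hab)
  rw [← parity_sub, ← parity_sub, chebPair, map_add, h1, mul_comm (chebU wVar _), h2, parity,
    parity]
  ring

theorem constTerm_chebU_sub {a b : ℤ} (hab : b ≤ a) :
    constTerm ℤ (chebU tPlusInv (a - b)) = (parity ℚ a - parity ℚ b) ^ 2 := by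
  rw [constTerm_chebU (sub_nonneg.2 hab), ← parity_sub, parity]

theorem constTerm_mul_parity (f : ℚ[T;T⁻¹]) (a b : ℤ) :
    constTerm ℤ (f * (parity _ a - parity _ b)) =
      constTerm ℤ f * (parity ℚ a - parity ℚ b) := by
  rw [parity, parity, parity, parity, ← Int.cast_sub, ← Int.cast_sub, mul_comm, ← zsmul_eq_mul,
    map_zsmul, zsmul_eq_mul, mul_comm]

end ConstantTerms

/-- If a weight `F` satisfies a Pieri rule with factor `p`, and `L (X * F l)` is the indicator of
shapes with `t` odd rows plus `s` times the indicator of shapes with `t'` odd rows, then the numbers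
of tableaux are given by `L (X * p ^ m * F 0)`. -/
theorem ncard_SYTOdd_add {A : Type*} [CommRing A] [Algebra ℚ A] (L : A →ₗ[ℚ] ℚ) {k : ℕ}
    {F : (ℕ → ℕ) → A} {p : A}
    (hzero : ∀ l : ℕ → ℕ, ∀ i, i + 1 < k → l i = l (i + 1) →
      F (Function.update l (i + 1) (l (i + 1) + 1)) = 0)
    (hsum : ∀ l : ℕ → ℕ, ∑ i ∈ Finset.range k, F (Function.update l i (l i + 1)) = p * F l)
    {X : A} {c s : ℚ} {t t' : ℕ}
    (hw : ∀ l : ℕ → ℕ, (∀ i, l (i + 1) ≤ l i) → L (X * F l) =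
      c * ((if oddCount k l = t then 1 else 0) + s * (if oddCount k l = t' then 1 else 0)))
    (m : ℕ) : c * ((SYTOdd k t m).ncard + s * (SYTOdd k t' m).ncard) = L (X * (p ^ m * F 0)) := by
  rw [← sum_standardTableaux_eq_pow k F p hzero hsum m, Finset.mul_sum, map_sum,
    Finset.sum_congr rfl fun T _ => hw T.1.rowLen fun i => T.1.rowLen_anti i (i + 1) i.le_succ,
    ncard_SYTOdd, ncard_SYTOdd, ← Finset.mul_sum, Finset.sum_add_distrib, ← Finset.mul_sum]
  push_cast
  rfl

/-! ### The weights on row lengths, with the staircase shift. -/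

section Shapes

theorem parity_natCast (n : ℕ) : parity ℚ (n : ℤ) = ((n % 2 : ℕ) : ℚ) := by
  rw [parity]
  norm_cast

/-- `weight₅` as a function of the row lengths. -/
noncomputable def shapeWeight₅ (l : ℕ → ℕ) : Laurent₂ :=
  weight₅ zVar wVar (l 0 + 4) (l 1 + 3) (l 2 + 2) (l 3 + 1) (l 4)

theorem shapeWeight₅_eq_zero (l : ℕ → ℕ) (i : ℕ) (hi : i + 1 < 5) (h : l i = l (i + 1)) :
    shapeWeight₅ (Function.update l (i + 1) (l (i + 1) + 1)) = 0 := by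
  have hi' : i < 4 := by omega
  interval_cases i
  all_goals simp only [zero_add, Nat.reduceAdd] at h
  all_goals simp [shapeWeight₅, h, add_assoc, weight₅_self₁, weight₅_self₂, weight₅_self₃,
    weight₅_self₄]

theorem sum_shapeWeight₅ (l : ℕ → ℕ) : ∑ i ∈ Finset.range 5,
    shapeWeight₅ (Function.update l i (l i + 1)) = (zVar + wVar + 1) * shapeWeight₅ l := by
  rw [shapeWeight₅, ← weight₅_pieri]
  simp [Finset.sum_range_succ, shapeWeight₅, add_right_comm _ (1 : ℤ)]

/-- `weight₄` as a function of the row lengths. -/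
noncomputable def shapeWeight₄ (l : ℕ → ℕ) : Laurent₂ :=
  weight₄ zVar wVar (l 0 + 3) (l 1 + 2) (l 2 + 1) (l 3)

theorem shapeWeight₄_eq_zero (l : ℕ → ℕ) (i : ℕ) (hi : i + 1 < 4) (h : l i = l (i + 1)) :
    shapeWeight₄ (Function.update l (i + 1) (l (i + 1) + 1)) = 0 := by
  have hi' : i < 3 := by omega
  interval_cases i
  all_goals simp only [zero_add, Nat.reduceAdd] at h
  all_goals simp [shapeWeight₄, h, add_assoc, weight₄_self₁, weight₄_self₂, weight₄_self₃]

theorem sum_shapeWeight₄ (l : ℕ → ℕ) : ∑ i ∈ Finset.range 4,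
    shapeWeight₄ (Function.update l i (l i + 1)) = (zVar + wVar) * shapeWeight₄ l := by
  rw [shapeWeight₄, ← weight₄_pieri]
  simp [Finset.sum_range_succ, shapeWeight₄, add_right_comm _ (1 : ℤ)]

/-- `signWeight₄` as a function of the row lengths. -/
noncomputable def shapeSignWeight₄ (l : ℕ → ℕ) : ℚ[T;T⁻¹] :=
  signWeight₄ tPlusInv (l 0 + 3) (l 1 + 2) (l 2 + 1) (l 3)

theorem shapeSignWeight₄_eq_zero (l : ℕ → ℕ) (i : ℕ) (hi : i + 1 < 4) (h : l i = l (i + 1)) :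
    shapeSignWeight₄ (Function.update l (i + 1) (l (i + 1) + 1)) = 0 := by
  have hi' : i < 3 := by omega
  interval_cases i
  all_goals simp only [zero_add, Nat.reduceAdd] at h
  all_goals simp [shapeSignWeight₄, h, add_assoc, signWeight₄_self₁, signWeight₄_self₂,
    signWeight₄_self₃]

theorem sum_shapeSignWeight₄ (l : ℕ → ℕ) : ∑ i ∈ Finset.range 4,
    shapeSignWeight₄ (Function.update l i (l i + 1)) = tPlusInv * shapeSignWeight₄ l := by
  rw [shapeSignWeight₄, ← signWeight₄_pieri]
  simp [Finset.sum_range_succ, shapeSignWeight₄, add_right_comm _ (1 : ℤ)]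

/-- `weight₃` as a function of the row lengths. -/
noncomputable def shapeWeight₃ (l : ℕ → ℕ) : ℚ[T;T⁻¹] :=
  weight₃ tPlusInv (l 0 + 2) (l 1 + 1) (l 2)

theorem shapeWeight₃_eq_zero (l : ℕ → ℕ) (i : ℕ) (hi : i + 1 < 3) (h : l i = l (i + 1)) :
    shapeWeight₃ (Function.update l (i + 1) (l (i + 1) + 1)) = 0 := by
  have hi' : i < 2 := by omega
  interval_cases i
  all_goals simp only [zero_add, Nat.reduceAdd] at h
  all_goals simp [shapeWeight₃, h, add_assoc, weight₃, chebU_zero]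

theorem sum_shapeWeight₃ (l : ℕ → ℕ) : ∑ i ∈ Finset.range 3,
    shapeWeight₃ (Function.update l i (l i + 1)) = (tPlusInv + 1) * shapeWeight₃ l := by
  rw [shapeWeight₃, ← weight₃_pieri]
  simp [Finset.sum_range_succ, shapeWeight₃, add_right_comm _ (1 : ℤ)]

/-- The weight of a shape with at most two rows. -/
noncomputable def shapeWeight₂ (l : ℕ → ℕ) : ℚ[T;T⁻¹] := chebU tPlusInv (l 0 + 1 - l 1)

theorem shapeWeight₂_eq_zero (l : ℕ → ℕ) (i : ℕ) (hi : i + 1 < 2) (h : l i = l (i + 1)) :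
    shapeWeight₂ (Function.update l (i + 1) (l (i + 1) + 1)) = 0 := by
  obtain rfl : i = 0 := by omega
  simp only [zero_add] at h
  simp [shapeWeight₂, h, chebU_zero]

theorem sum_shapeWeight₂ (l : ℕ → ℕ) : ∑ i ∈ Finset.range 2,
    shapeWeight₂ (Function.update l i (l i + 1)) = tPlusInv * shapeWeight₂ l := by
  rw [shapeWeight₂, ← chebU_pieri]
  simp [Finset.sum_range_succ, shapeWeight₂, add_right_comm _ (1 : ℤ)]

/-- The weight of a shape with at most two rows belonging to the matrices of determinant `-1`. -/
def shapeSignWeight₂ (l : ℕ → ℕ) : ℚ := parity ℚ (l 0 + 1) - parity ℚ (l 1)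

theorem shapeSignWeight₂_eq_zero (l : ℕ → ℕ) (i : ℕ) (hi : i + 1 < 2) (h : l i = l (i + 1)) :
    shapeSignWeight₂ (Function.update l (i + 1) (l (i + 1) + 1)) = 0 := by
  obtain rfl : i = 0 := by omega
  simp only [zero_add] at h
  simp [shapeSignWeight₂, h]

theorem sum_shapeSignWeight₂ (l : ℕ → ℕ) : ∑ i ∈ Finset.range 2,
    shapeSignWeight₂ (Function.update l i (l i + 1)) = 0 * shapeSignWeight₂ l := by
  simp only [Finset.sum_range_succ, Finset.sum_range_zero, shapeSignWeight₂, Function.update_self,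
    Function.update_of_ne zero_ne_one, Function.update_of_ne one_ne_zero, Nat.cast_add,
    Nat.cast_one, parity_add_one]
  ring

end Shapes

/-! ### Constant terms as indicators of the number of odd rows. -/

section ParityWeights

/-- The constant term of `weight₄`, up to a factor `2`, in terms of parities. -/
def parityPfaffian (a b c d : ℚ) : ℚ :=
  (a - b) ^ 2 * (c - d) ^ 2 - (a - c) ^ 2 * (b - d) ^ 2 + (a - d) ^ 2 * (b - c) ^ 2

theorem constTerm_weight₄ {a b c d : ℤ} (h : b ≤ a ∧ c ≤ b ∧ d ≤ c) :
    constTerm _ (weight₄ zVar wVar a b c d) =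
      2 * parityPfaffian (parity ℚ a) (parity ℚ b) (parity ℚ c) (parity ℚ d) := by
  obtain ⟨hab, hbc, hcd⟩ := h
  rw [weight₄, map_add, map_sub, constTerm_chebPair hab hcd,
    constTerm_chebPair (hbc.trans hab) (hcd.trans hbc),
    constTerm_chebPair ((hcd.trans hbc).trans hab) hbc, parityPfaffian]
  ring

/-- The constant term of `weight₅`, up to a factor `2`, in terms of parities. -/
def parityPfaffian₅ (a b c d e : ℚ) : ℚ :=
  parityPfaffian b c d e - parityPfaffian a c d e + parityPfaffian a b d e -
    parityPfaffian a b c e + parityPfaffian a b c d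

theorem constTerm_weight₅ {a b c d e : ℤ} (h : b ≤ a ∧ c ≤ b ∧ d ≤ c ∧ e ≤ d) :
    constTerm _ (weight₅ zVar wVar a b c d e) = 2 * parityPfaffian₅ (parity ℚ a) (parity ℚ b)
      (parity ℚ c) (parity ℚ d) (parity ℚ e) := by
  obtain ⟨hab, hbc, hcd, hde⟩ := h
  rw [weight₅, map_add, map_sub, map_add, map_sub, constTerm_weight₄ ⟨hbc, hcd, hde⟩,
    constTerm_weight₄ ⟨hbc.trans hab, hcd, hde⟩, constTerm_weight₄ ⟨hab, hcd.trans hbc, hde⟩,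
    constTerm_weight₄ ⟨hab, hbc, hde.trans hcd⟩, constTerm_weight₄ ⟨hab, hbc, hcd⟩,
    parityPfaffian₅]
  ring

theorem parity_add_three (a : ℤ) : parity ℚ (a + 3) = 1 - parity ℚ a := by
  rw [← parity_add_one, parity, parity, show (a + 3) % 2 = (a + 1) % 2 by omega]

theorem parity_add_four (a : ℤ) : parity ℚ (a + 4) = parity ℚ a := by
  rw [parity, parity, show (a + 4) % 2 = a % 2 by omega]

variable {l : ℕ → ℕ}

/-- The factor `8` is the order of the Weyl group of `SO(5)`; once only parities remain, the `32`
cases are checked. -/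
theorem constTerm_shapeWeight₅ (hl : ∀ i, l (i + 1) ≤ l i) :
    constTerm _ (1 * shapeWeight₅ l) =
      8 * ((if oddCount 5 l = 0 then 1 else 0) + 1 * (if oddCount 5 l = 5 then 1 else 0)) := by
  have h0 : l 1 ≤ l 0 := hl 0
  have h1 : l 2 ≤ l 1 := hl 1
  have h2 : l 3 ≤ l 2 := hl 2
  have h3 : l 4 ≤ l 3 := hl 3
  rw [one_mul, shapeWeight₅, constTerm_weight₅ (by omega)]
  simp only [parity_add_one, parity_add_two, parity_add_three, parity_add_four, parity_natCast,
    oddCount, Finset.sum_range_succ, Finset.sum_range_zero]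
  rcases Nat.mod_two_eq_zero_or_one (l 0) with h0 | h0 <;>
  rcases Nat.mod_two_eq_zero_or_one (l 1) with h1 | h1 <;>
  rcases Nat.mod_two_eq_zero_or_one (l 2) with h2 | h2 <;>
  rcases Nat.mod_two_eq_zero_or_one (l 3) with h3 | h3 <;>
  rcases Nat.mod_two_eq_zero_or_one (l 4) with h4 | h4 <;>
  rw [h0, h1, h2, h3, h4] <;> norm_num [parityPfaffian₅, parityPfaffian]

/-- Multiplication by `e_1` adds one cell; all rows can become even or all odd only from one or four
odd rows. -/
theorem constTerm_mul_shapeWeight₅ (hl : ∀ i, l (i + 1) ≤ l i) :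
    constTerm _ ((zVar + wVar + 1) * shapeWeight₅ l) =
      8 * ((if oddCount 5 l = 1 then 1 else 0) + 1 * (if oddCount 5 l = 4 then 1 else 0)) := by
  have h0 : l 1 ≤ l 0 := hl 0
  have h1 : l 2 ≤ l 1 := hl 1
  have h2 : l 3 ≤ l 2 := hl 2
  have h3 : l 4 ≤ l 3 := hl 3
  rw [shapeWeight₅, ← weight₅_pieri]
  simp only [map_add]
  rw [constTerm_weight₅, constTerm_weight₅, constTerm_weight₅, constTerm_weight₅,
    constTerm_weight₅]
  rotate_left
  -- After adding a cell the shifted lengths may coincide but stay weakly decreasing, which is all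
  -- that the constant term formula needs.
  iterate 5 omega
  simp only [parity_add_one, parity_add_two, parity_add_three, parity_add_four, parity_natCast,
    oddCount, Finset.sum_range_succ, Finset.sum_range_zero]
  rcases Nat.mod_two_eq_zero_or_one (l 0) with h0 | h0 <;>
  rcases Nat.mod_two_eq_zero_or_one (l 1) with h1 | h1 <;>
  rcases Nat.mod_two_eq_zero_or_one (l 2) with h2 | h2 <;>
  rcases Nat.mod_two_eq_zero_or_one (l 3) with h3 | h3 <;>
  rcases Nat.mod_two_eq_zero_or_one (l 4) with h4 | h4 <;>
  rw [h0, h1, h2, h3, h4] <;> norm_num [parityPfaffian₅, parityPfaffian]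

/-- Multiplication by `e_2` adds cells to two different rows, which must be the two odd rows or the
two even ones. -/
theorem constTerm_two_mul_shapeWeight₅ (hl : ∀ i, l (i + 1) ≤ l i) :
    constTerm _ ((2 + zVar * wVar + (zVar + wVar)) * shapeWeight₅ l) =
      8 * ((if oddCount 5 l = 2 then 1 else 0) + 1 * (if oddCount 5 l = 3 then 1 else 0)) := by
  have h0 : l 1 ≤ l 0 := hl 0
  have h1 : l 2 ≤ l 1 := hl 1
  have h2 : l 3 ≤ l 2 := hl 2
  have h3 : l 4 ≤ l 3 := hl 3
  rw [shapeWeight₅, ← weight₅_pieri_two]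
  simp only [map_add]
  rw [constTerm_weight₅, constTerm_weight₅, constTerm_weight₅, constTerm_weight₅,
    constTerm_weight₅, constTerm_weight₅, constTerm_weight₅, constTerm_weight₅,
    constTerm_weight₅, constTerm_weight₅]
  rotate_left
  iterate 10 omega
  simp only [parity_add_one, parity_add_two, parity_add_three, parity_add_four, parity_natCast,
    oddCount, Finset.sum_range_succ, Finset.sum_range_zero]
  rcases Nat.mod_two_eq_zero_or_one (l 0) with h0 | h0 <;>
  rcases Nat.mod_two_eq_zero_or_one (l 1) with h1 | h1 <;>
  rcases Nat.mod_two_eq_zero_or_one (l 2) with h2 | h2 <;>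
  rcases Nat.mod_two_eq_zero_or_one (l 3) with h3 | h3 <;>
  rcases Nat.mod_two_eq_zero_or_one (l 4) with h4 | h4 <;>
  rw [h0, h1, h2, h3, h4] <;> norm_num [parityPfaffian₅, parityPfaffian]

theorem constTerm_shapeWeight₄ (hl : ∀ i, l (i + 1) ≤ l i) :
    constTerm _ (1 * shapeWeight₄ l) =
      4 * ((if oddCount 4 l = 0 then 1 else 0) + 1 * (if oddCount 4 l = 4 then 1 else 0)) := by
  have h0 : l 1 ≤ l 0 := hl 0
  have h1 : l 2 ≤ l 1 := hl 1
  have h2 : l 3 ≤ l 2 := hl 2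
  rw [one_mul, shapeWeight₄, constTerm_weight₄ (by omega)]
  simp only [parity_add_one, parity_add_two, parity_add_three, parity_natCast,
    oddCount, Finset.sum_range_succ, Finset.sum_range_zero]
  rcases Nat.mod_two_eq_zero_or_one (l 0) with h0 | h0 <;>
  rcases Nat.mod_two_eq_zero_or_one (l 1) with h1 | h1 <;>
  rcases Nat.mod_two_eq_zero_or_one (l 2) with h2 | h2 <;>
  rcases Nat.mod_two_eq_zero_or_one (l 3) with h3 | h3 <;>
  rw [h0, h1, h2, h3] <;> norm_num [parityPfaffian]

theorem constTerm_mul_shapeWeight₄ (hl : ∀ i, l (i + 1) ≤ l i) :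
    constTerm _ ((zVar + wVar) * shapeWeight₄ l) =
      4 * ((if oddCount 4 l = 1 then 1 else 0) + 1 * (if oddCount 4 l = 3 then 1 else 0)) := by
  have h0 : l 1 ≤ l 0 := hl 0
  have h1 : l 2 ≤ l 1 := hl 1
  have h2 : l 3 ≤ l 2 := hl 2
  rw [shapeWeight₄, ← weight₄_pieri]
  simp only [map_add]
  rw [constTerm_weight₄, constTerm_weight₄, constTerm_weight₄, constTerm_weight₄]
  rotate_left
  iterate 4 omega
  simp only [parity_add_one, parity_add_two, parity_add_three, parity_natCast,
    oddCount, Finset.sum_range_succ, Finset.sum_range_zero]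
  rcases Nat.mod_two_eq_zero_or_one (l 0) with h0 | h0 <;>
  rcases Nat.mod_two_eq_zero_or_one (l 1) with h1 | h1 <;>
  rcases Nat.mod_two_eq_zero_or_one (l 2) with h2 | h2 <;>
  rcases Nat.mod_two_eq_zero_or_one (l 3) with h3 | h3 <;>
  rw [h0, h1, h2, h3] <;> norm_num [parityPfaffian]

/-- The case `t = k - t`: with two odd and two even rows, both choices of strip contribute, so the
indicator is counted twice. -/
theorem constTerm_two_mul_shapeWeight₄ (hl : ∀ i, l (i + 1) ≤ l i) :
    constTerm _ ((2 + zVar * wVar) * shapeWeight₄ l) =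
      4 * ((if oddCount 4 l = 2 then 1 else 0) + 1 * (if oddCount 4 l = 2 then 1 else 0)) := by
  have h0 : l 1 ≤ l 0 := hl 0
  have h1 : l 2 ≤ l 1 := hl 1
  have h2 : l 3 ≤ l 2 := hl 2
  rw [shapeWeight₄, ← weight₄_pieri_two]
  simp only [map_add]
  rw [constTerm_weight₄, constTerm_weight₄, constTerm_weight₄, constTerm_weight₄,
    constTerm_weight₄, constTerm_weight₄]
  rotate_left
  iterate 6 omega
  simp only [parity_add_one, parity_add_two, parity_add_three, parity_natCast,
    oddCount, Finset.sum_range_succ, Finset.sum_range_zero]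
  rcases Nat.mod_two_eq_zero_or_one (l 0) with h0 | h0 <;>
  rcases Nat.mod_two_eq_zero_or_one (l 1) with h1 | h1 <;>
  rcases Nat.mod_two_eq_zero_or_one (l 2) with h2 | h2 <;>
  rcases Nat.mod_two_eq_zero_or_one (l 3) with h3 | h3 <;>
  rw [h0, h1, h2, h3] <;> norm_num [parityPfaffian]

theorem constTerm_signWeight₄ {a b c d : ℤ} (h : b ≤ a ∧ c ≤ b ∧ d ≤ c) :
    constTerm _ (signWeight₄ tPlusInv a b c d) =
      (parity ℚ a - parity ℚ b) ^ 2 * (parity ℚ c - parity ℚ d) -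
      (parity ℚ a - parity ℚ c) ^ 2 * (parity ℚ b - parity ℚ d) +
      (parity ℚ a - parity ℚ d) ^ 2 * (parity ℚ b - parity ℚ c) +
      (parity ℚ b - parity ℚ c) ^ 2 * (parity ℚ a - parity ℚ d) -
      (parity ℚ b - parity ℚ d) ^ 2 * (parity ℚ a - parity ℚ c) +
      (parity ℚ c - parity ℚ d) ^ 2 * (parity ℚ a - parity ℚ b) := by
  obtain ⟨hab, hbc, hcd⟩ := h
  simp only [signWeight₄, map_add, map_sub, constTerm_mul_parity, constTerm_chebU_sub hab,
    constTerm_chebU_sub hbc, constTerm_chebU_sub hcd, constTerm_chebU_sub (hbc.trans hab),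
    constTerm_chebU_sub (hcd.trans hbc), constTerm_chebU_sub ((hcd.trans hbc).trans hab)]

/-- Shapes with all rows odd carry the determinant character, which is `-1` on this component. -/
theorem constTerm_shapeSignWeight₄ (hl : ∀ i, l (i + 1) ≤ l i) :
    constTerm _ (1 * shapeSignWeight₄ l) =
      2 * ((if oddCount 4 l = 0 then 1 else 0) + -1 * (if oddCount 4 l = 4 then 1 else 0)) := by
  have h0 : l 1 ≤ l 0 := hl 0
  have h1 : l 2 ≤ l 1 := hl 1
  have h2 : l 3 ≤ l 2 := hl 2
  rw [one_mul, shapeSignWeight₄, constTerm_signWeight₄ (by omega)]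
  simp only [parity_add_one, parity_add_two, parity_add_three, parity_natCast,
    oddCount, Finset.sum_range_succ, Finset.sum_range_zero]
  rcases Nat.mod_two_eq_zero_or_one (l 0) with h0 | h0 <;>
  rcases Nat.mod_two_eq_zero_or_one (l 1) with h1 | h1 <;>
  rcases Nat.mod_two_eq_zero_or_one (l 2) with h2 | h2 <;>
  rcases Nat.mod_two_eq_zero_or_one (l 3) with h3 | h3 <;>
  rw [h0, h1, h2, h3] <;> norm_num

theorem constTerm_mul_shapeSignWeight₄ (hl : ∀ i, l (i + 1) ≤ l i) :
    constTerm _ (tPlusInv * shapeSignWeight₄ l) =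
      2 * ((if oddCount 4 l = 1 then 1 else 0) + -1 * (if oddCount 4 l = 3 then 1 else 0)) := by
  have h0 : l 1 ≤ l 0 := hl 0
  have h1 : l 2 ≤ l 1 := hl 1
  have h2 : l 3 ≤ l 2 := hl 2
  rw [shapeSignWeight₄, ← signWeight₄_pieri]
  simp only [map_add]
  rw [constTerm_signWeight₄, constTerm_signWeight₄, constTerm_signWeight₄, constTerm_signWeight₄]
  rotate_left
  iterate 4 omega
  simp only [parity_add_one, parity_add_two, parity_add_three, parity_natCast,
    oddCount, Finset.sum_range_succ, Finset.sum_range_zero]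
  rcases Nat.mod_two_eq_zero_or_one (l 0) with h0 | h0 <;>
  rcases Nat.mod_two_eq_zero_or_one (l 1) with h1 | h1 <;>
  rcases Nat.mod_two_eq_zero_or_one (l 2) with h2 | h2 <;>
  rcases Nat.mod_two_eq_zero_or_one (l 3) with h3 | h3 <;>
  rw [h0, h1, h2, h3] <;> norm_num

theorem constTerm_weight₃ {a b c : ℤ} (h : b ≤ a ∧ c ≤ b) :
    constTerm _ (weight₃ tPlusInv a b c) = (parity ℚ a - parity ℚ b) ^ 2 -
      (parity ℚ a - parity ℚ c) ^ 2 + (parity ℚ b - parity ℚ c) ^ 2 := by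
  simp only [weight₃, map_add, map_sub, constTerm_chebU_sub h.1, constTerm_chebU_sub h.2,
    constTerm_chebU_sub (h.2.trans h.1)]

theorem constTerm_shapeWeight₃ (hl : ∀ i, l (i + 1) ≤ l i) :
    constTerm _ (1 * shapeWeight₃ l) =
      2 * ((if oddCount 3 l = 0 then 1 else 0) + 1 * (if oddCount 3 l = 3 then 1 else 0)) := by
  have h0 : l 1 ≤ l 0 := hl 0
  have h1 : l 2 ≤ l 1 := hl 1
  rw [one_mul, shapeWeight₃, constTerm_weight₃ (by omega)]
  simp only [parity_add_one, parity_add_two, parity_natCast,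
    oddCount, Finset.sum_range_succ, Finset.sum_range_zero]
  rcases Nat.mod_two_eq_zero_or_one (l 0) with h0 | h0 <;>
  rcases Nat.mod_two_eq_zero_or_one (l 1) with h1 | h1 <;>
  rcases Nat.mod_two_eq_zero_or_one (l 2) with h2 | h2 <;>
  rw [h0, h1, h2] <;> norm_num

theorem constTerm_mul_shapeWeight₃ (hl : ∀ i, l (i + 1) ≤ l i) :
    constTerm _ ((tPlusInv + 1) * shapeWeight₃ l) =
      2 * ((if oddCount 3 l = 1 then 1 else 0) + 1 * (if oddCount 3 l = 2 then 1 else 0)) := by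
  have h0 : l 1 ≤ l 0 := hl 0
  have h1 : l 2 ≤ l 1 := hl 1
  rw [shapeWeight₃, ← weight₃_pieri]
  simp only [map_add]
  rw [constTerm_weight₃, constTerm_weight₃, constTerm_weight₃]
  rotate_left
  iterate 3 omega
  simp only [parity_add_one, parity_add_two, parity_natCast,
    oddCount, Finset.sum_range_succ, Finset.sum_range_zero]
  rcases Nat.mod_two_eq_zero_or_one (l 0) with h0 | h0 <;>
  rcases Nat.mod_two_eq_zero_or_one (l 1) with h1 | h1 <;>
  rcases Nat.mod_two_eq_zero_or_one (l 2) with h2 | h2 <;>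
  rw [h0, h1, h2] <;> norm_num

theorem constTerm_shapeWeight₂ (hl : ∀ i, l (i + 1) ≤ l i) :
    constTerm _ (1 * shapeWeight₂ l) =
      1 * ((if oddCount 2 l = 0 then 1 else 0) + 1 * (if oddCount 2 l = 2 then 1 else 0)) := by
  have h0 : l 1 ≤ l 0 := hl 0
  rw [one_mul, shapeWeight₂, constTerm_chebU_sub (by omega)]
  simp only [parity_add_one, parity_natCast, oddCount, Finset.sum_range_succ,
    Finset.sum_range_zero]
  rcases Nat.mod_two_eq_zero_or_one (l 0) with h0 | h0 <;>
  rcases Nat.mod_two_eq_zero_or_one (l 1) with h1 | h1 <;>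
  rw [h0, h1] <;> norm_num

theorem constTerm_mul_shapeWeight₂ (hl : ∀ i, l (i + 1) ≤ l i) :
    constTerm _ (tPlusInv * shapeWeight₂ l) =
      1 * ((if oddCount 2 l = 1 then 1 else 0) + 1 * (if oddCount 2 l = 1 then 1 else 0)) := by
  have h0 : l 1 ≤ l 0 := hl 0
  rw [shapeWeight₂, ← chebU_pieri, map_add, constTerm_chebU_sub (by omega),
    constTerm_chebU_sub (by omega)]
  simp only [parity_add_one, parity_natCast, oddCount, Finset.sum_range_succ,
    Finset.sum_range_zero]
  rcases Nat.mod_two_eq_zero_or_one (l 0) with h0 | h0 <;>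
  rcases Nat.mod_two_eq_zero_or_one (l 1) with h1 | h1 <;>
  rw [h0, h1] <;> norm_num

theorem shapeSignWeight₂_eq (l : ℕ → ℕ) : LinearMap.id (R := ℚ) (1 * shapeSignWeight₂ l) =
      1 * ((if oddCount 2 l = 0 then 1 else 0) + -1 * (if oddCount 2 l = 2 then 1 else 0)) := by
  rw [one_mul, LinearMap.id_apply, shapeSignWeight₂]
  simp only [parity_add_one, parity_natCast, oddCount, Finset.sum_range_succ,
    Finset.sum_range_zero]
  rcases Nat.mod_two_eq_zero_or_one (l 0) with h0 | h0 <;>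
  rcases Nat.mod_two_eq_zero_or_one (l 1) with h1 | h1 <;>
  rw [h0, h1] <;> norm_num

end ParityWeights

/-! ### Weights of the empty shape, and semicircle moments. -/

section Counts

theorem ncard_SYTOdd_of_mod_ne {k t m : ℕ} (h : m % 2 ≠ t % 2) : (SYTOdd k t m).ncard = 0 := by
  rw [SYTOdd_eq_empty h, Set.ncard_empty]

/-- The first factor is `(2 - z) (2 - w)`, which is `(aVar - bVar) ^ 2`; the second is `(z - w) ^
2`. -/
theorem shapeWeight₅_zero : shapeWeight₅ 0 =
    (4 - 2 * (aVar * bVar) + (aVar ^ 2 + bVar ^ 2 - 4)) *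
      ((4 - aVar ^ 2) * (4 - bVar ^ 2)) := by
  have h := weight₅_delta zVar wVar
  rw [zVar_add_wVar, zVar_mul_wVar] at h
  simp only [shapeWeight₅, Pi.zero_apply, Nat.cast_zero, zero_add, h]
  ring

theorem shapeWeight₄_zero : shapeWeight₄ 0 = (4 - aVar ^ 2) * (4 - bVar ^ 2) := by
  have h := weight₄_delta zVar wVar
  rw [zVar_add_wVar, zVar_mul_wVar] at h
  simp only [shapeWeight₄, Pi.zero_apply, Nat.cast_zero, zero_add, h]
  ring

theorem shapeSignWeight₄_zero : shapeSignWeight₄ 0 = 4 - tPlusInv ^ 2 := by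
  simp only [shapeSignWeight₄, Pi.zero_apply, Nat.cast_zero, zero_add, signWeight₄_delta]

theorem shapeWeight₃_zero : shapeWeight₃ 0 = 2 - tPlusInv := by
  simp only [shapeWeight₃, Pi.zero_apply, Nat.cast_zero, zero_add, weight₃, sub_zero, chebU_two]
  norm_num [chebU_one]
  ring

theorem shapeWeight₂_zero : shapeWeight₂ 0 = 1 := by
  simp [shapeWeight₂, chebU_one]

theorem semicircleMoment_two_mul (n : ℕ) : semicircleMoment (2 * n) = 2 * catalan n := by
  rw [semicircleMoment, if_pos (even_two_mul n), Nat.mul_div_cancel_left _ two_pos]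

theorem semicircleMoment_add_two (n : ℕ) :
    semicircleMoment (2 * n + 2) = 2 * catalan (n + 1) := semicircleMoment_two_mul (n + 1)

theorem semicircleMoment_add_four (n : ℕ) :
    semicircleMoment (2 * n + 4) = 2 * catalan (n + 2) := semicircleMoment_two_mul (n + 2)

theorem semicircleMoment_two_mul_add_one (n : ℕ) : semicircleMoment (2 * n + 1) = 0 := by
  rw [semicircleMoment, if_neg (by simp)]

end Counts

/-! ### Riordan numbers as moments of the trace on `SO(3)`, and their closed form. -/

section Riordan

/-- The heights to which a Riordan path can step from height `c`. -/
def riordanNext (c : ℕ) : Finset ℕ := if c = 0 then {1} else {c - 1, c, c + 1}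

theorem mem_riordanNext {c s : ℕ} : s ∈ riordanNext c ↔
    (s = c + 1 ∨ s = c ∨ s + 1 = c) ∧ ¬(c = 0 ∧ s = 0) := by
  rw [riordanNext]
  split_ifs with h
  · rw [Finset.mem_singleton]
    omega
  · simp only [Finset.mem_insert, Finset.mem_singleton]
    omega

/-- The initial pieces of length `m` of Riordan paths. -/
def riordanPrefixes : (m : ℕ) → Finset (Fin (m + 1) → ℕ)
  | 0 => {0}
  | m + 1 => ((riordanPrefixes m).sigma fun h => riordanNext (h (Fin.last m))).image
      fun p => Fin.snoc (α := fun _ => ℕ) p.1 p.2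

theorem mem_riordanPrefixes {m : ℕ} {h : Fin (m + 1) → ℕ} : h ∈ riordanPrefixes m ↔
    h 0 = 0 ∧ ∀ i : Fin m, h i.succ ∈ riordanNext (h i.castSucc) := by
  induction m with
  | zero =>
    rw [riordanPrefixes, Finset.mem_singleton]
    refine ⟨fun h => by simp [h], fun h => ?_⟩
    funext i
    obtain rfl : i = 0 := Subsingleton.elim (α := Fin 1) i 0
    exact h.1
  | succ m ih =>
    rw [riordanPrefixes, Finset.mem_image]
    constructor
    · rintro ⟨⟨g, s⟩, hp, rfl⟩
      rw [Finset.mem_sigma, ih] at hp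
      obtain ⟨⟨h0, hs⟩, hlast⟩ := hp
      refine ⟨?_, fun i => ?_⟩
      · have : (0 : Fin (m + 2)) = Fin.castSucc 0 := rfl
        rw [this, Fin.snoc_castSucc]
        exact h0
      · induction i using Fin.lastCases with
        | last => simpa using hlast
        | cast i =>
          rw [Fin.snoc_castSucc, ← Fin.castSucc_succ, Fin.snoc_castSucc]
          exact hs i
    · rintro ⟨h0, hs⟩
      refine ⟨⟨Fin.init h, h (Fin.last _)⟩, ?_, Fin.snoc_init_self h⟩
      rw [Finset.mem_sigma, ih]
      refine ⟨⟨h0, fun i => ?_⟩, hs (Fin.last m)⟩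
      exact hs i.castSucc

/-- The analogue for paths of the weighted sum over tableaux: `F` is an eigenvector of the step
operator. -/
theorem sum_riordanPrefixes {A : Type*} [CommSemiring A] (F : ℕ → A) (p : A)
    (hF : ∀ c, ∑ s ∈ riordanNext c, F s = p * F c) (m : ℕ) :
    ∑ h ∈ riordanPrefixes m, F (h (Fin.last m)) = p ^ m * F 0 := by
  induction m with
  | zero => simp [riordanPrefixes]
  | succ m ih =>
    rw [riordanPrefixes, Finset.sum_image, Finset.sum_sigma, pow_succ', mul_assoc, ← ih,
      Finset.mul_sum]
    · refine Finset.sum_congr rfl fun h _ => ?_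
      rw [← hF]
      simp
    · rintro ⟨g, s⟩ _ ⟨g', s'⟩ _ h
      have h1 := congrArg Fin.init h
      have h2 := congrFun h (Fin.last (m + 1))
      simp only [Fin.init_snoc, Fin.snoc_last] at h1 h2
      rw [h1, h2]

theorem riordan_eq_sum (m : ℕ) :
    riordan m = ∑ h ∈ riordanPrefixes m, if h (Fin.last m) = 0 then 1 else 0 := by
  rw [← Finset.card_filter, ← Set.ncard_coe_finset, riordan]
  congr 1
  ext h
  simp only [Set.mem_ofPred_eq, IsRiordanPath, Finset.coe_filter, mem_riordanPrefixes,
    mem_riordanNext]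
  tauto

/-- The character of the odd-dimensional representation of `SO(3)` with highest weight `n`. -/
noncomputable def oddCharacter (n : ℕ) : ℚ[T;T⁻¹] :=
  chebU tPlusInv (n + 1) + chebU tPlusInv n

/-- Clebsch–Gordan: tensoring with the standard representation of `SO(3)` moves the highest weight
by at most `1`, and takes the trivial representation only to the standard one. These are the steps
of a Riordan path. -/
theorem sum_oddCharacter (c : ℕ) :
    ∑ s ∈ riordanNext c, oddCharacter s = (tPlusInv + 1) * oddCharacter c := by
  rcases c with _ | c
  · simp only [riordanNext, if_true, Finset.sum_singleton, oddCharacter, Nat.cast_zero, zero_add,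
      Nat.cast_one, chebU_one, chebU_zero, one_add_one_eq_two, chebU_two]
    ring
  · have h1 := chebU_rec tPlusInv ((c : ℤ) + 2)
    have h2 := chebU_rec tPlusInv ((c : ℤ) + 1)
    rw [riordanNext, if_neg c.succ_ne_zero, Finset.sum_insert, Finset.sum_insert,
      Finset.sum_singleton]
    · simp only [oddCharacter, Nat.cast_add, Nat.cast_one, Nat.add_sub_cancel]
      simp only [add_sub_cancel_right, add_assoc, add_sub_assoc] at *
      norm_num at *
      linear_combination -h1 - h2
    · simp
    · simp only [Finset.mem_insert, Finset.mem_singleton]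
      omega

/-- Orthogonality to the trivial character; `2 - tPlusInv` is the Weyl density of `SO(3)`. -/
theorem constTerm_oddCharacter (n : ℕ) :
    constTerm ℤ ((2 - tPlusInv) * oddCharacter n) = 2 * if n = 0 then 1 else 0 := by
  rcases n with _ | n
  · have h := constTerm_chebU (n := 2) (by norm_num)
    have h1 := constTerm_chebU (n := 1) (by norm_num)
    rw [chebU_two] at h
    rw [chebU_one] at h1
    have h2 : (2 - tPlusInv) * oddCharacter 0 = 1 + 1 - tPlusInv := by
      simp only [oddCharacter, Nat.cast_zero, zero_add, chebU_one, chebU_zero]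
      ring
    rw [h2, map_sub, map_add, h, h1]
    norm_num
  · have h1 := chebU_rec tPlusInv ((n : ℤ) + 2)
    have h2 := chebU_rec tPlusInv ((n : ℤ) + 1)
    have h : (2 - tPlusInv) * oddCharacter (n + 1) = chebU tPlusInv ((n : ℤ) + 2) +
        chebU tPlusInv ((n : ℤ) + 1) - chebU tPlusInv ((n : ℤ) + 3) - chebU tPlusInv n := by
      simp only [oddCharacter, Nat.cast_add, Nat.cast_one]
      simp only [add_sub_cancel_right, add_assoc, add_sub_assoc] at *
      norm_num at *
      linear_combination -h1 - h2
    rw [h, map_sub, map_sub, map_add, constTerm_chebU (by omega), constTerm_chebU (by omega),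
      constTerm_chebU (by omega), constTerm_chebU (by omega), if_neg n.succ_ne_zero,
      show ((n : ℤ) + 2) % 2 = n % 2 by omega, show ((n : ℤ) + 3) % 2 = (n + 1) % 2 by omega]
    ring

theorem two_mul_riordan (m : ℕ) :
    2 * (riordan m : ℚ) = constTerm ℤ ((2 - tPlusInv) * (tPlusInv + 1) ^ m) := by
  have h0 : oddCharacter 0 = 1 := by
    simp [oddCharacter, chebU_one, chebU_zero]
  have h := sum_riordanPrefixes oddCharacter _ sum_oddCharacter m
  rw [h0, mul_one] at h
  rw [← h, Finset.mul_sum, map_sum, Finset.sum_congr rfl fun h _ => constTerm_oddCharacter _,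
    ← Finset.mul_sum, riordan_eq_sum]
  push_cast
  rfl

theorem sum_range_two_mul {A : Type*} [AddCommMonoid A] (f : ℕ → A) (n : ℕ) :
    ∑ j ∈ Finset.range (2 * n), f j =
      ∑ i ∈ Finset.range n, f (2 * i) + ∑ i ∈ Finset.range n, f (2 * i + 1) := by
  induction n with
  | zero => simp
  | succ n ih =>
    rw [Nat.mul_succ, Finset.sum_range_succ, Finset.sum_range_succ, ih, Finset.sum_range_succ,
      Finset.sum_range_succ]
    abel

/-- Expand `(tPlusInv + 1) ^ m` and pair the exponents `2 i` and `2 i + 1`: only even powers of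
`tPlusInv` have a constant term. -/
theorem riordan_eq_sum_choose (m : ℕ) : (riordan m : ℚ) = ∑ i ∈ Finset.range (m / 2 + 1),
    ((m.choose (2 * i) * (2 * i).choose i : ℚ) -
      m.choose (2 * i + 1) * (2 * i + 1).choose i) := by
  have hexp : (2 - tPlusInv) * (tPlusInv + 1) ^ m = ∑ j ∈ Finset.range (m + 1),
      (m.choose j : ℚ) • ((2 : ℚ) • tPlusInv ^ j - tPlusInv ^ (j + 1)) := by
    rw [add_pow, Finset.mul_sum]
    refine Finset.sum_congr rfl fun j _ => ?_
    simp only [Algebra.smul_def, map_natCast, map_ofNat]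
    ring
  have hext : ∀ f : ℕ → ℚ, ∑ j ∈ Finset.range (m + 1), (m.choose j : ℚ) * f j =
      ∑ j ∈ Finset.range (2 * (m / 2 + 1)), (m.choose j : ℚ) * f j := by
    intro f
    -- For even `m` the pairing needs one more index, `m + 1`, whose binomial coefficient is `0`.
    refine Finset.sum_subset (Finset.range_subset_range.2 (by omega)) fun j _ hj => ?_
    rw [Finset.mem_range, not_lt] at hj
    rw [Nat.choose_eq_zero_of_lt (by omega), Nat.cast_zero, zero_mul]
  apply mul_left_cancel₀ (two_ne_zero (α := ℚ))
  rw [two_mul_riordan, hexp, map_sum]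
  simp only [map_smul, map_sub, smul_eq_mul]
  rw [hext, sum_range_two_mul, ← Finset.sum_add_distrib, Finset.mul_sum]
  refine Finset.sum_congr rfl fun i _ => ?_
  have hodd : ¬ Even (2 * i + 1) := by simp
  have hcb : (((2 * i + 1 + 1).choose ((2 * i + 1 + 1) / 2) : ℕ) : ℚ) =
      2 * ((2 * i + 1).choose i : ℚ) := by
    rw [show (2 * i + 1 + 1) / 2 = i + 1 by omega, Nat.choose_succ_succ, Nat.choose_symm_half]
    push_cast
    ring
  rw [constTerm_tPlusInv_pow, constTerm_tPlusInv_pow, constTerm_tPlusInv_pow,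
    if_pos (even_two_mul i), if_neg hodd, if_pos ⟨i + 1, by ring⟩, hcb,
    Nat.mul_div_cancel_left _ two_pos]
  ring

/-- The two summands differ by a telescoping hypergeometric term. The right side vanishes at `n = m
/ 2 + 1`, where `m < 2 * n`, so the complete sums agree. -/
theorem sum_choose_telescope {m : ℕ} (hm : 1 ≤ m) (n : ℕ) (hn : n ≤ m / 2 + 1) :
    ∑ i ∈ Finset.range n, ((m.choose (2 * i) * (2 * i).choose i : ℚ) -
      m.choose (2 * i + 1) * (2 * i + 1).choose i) -
    1 / ((m : ℚ) + 1) * ∑ i ∈ Finset.Ico 1 n,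
      ((m + 1).choose i : ℚ) * ((m - i - 1).choose (i - 1) : ℚ) =
    -((n : ℚ) / (m - n + 1)) * (m.choose (2 * n) * (2 * n).choose n) := by
  induction n with
  | zero => simp
  | succ n ih =>
    -- In terms of `n` and `r` no truncated subtraction remains in the denominators; `1 ≤ m` gives
    -- `n + r ≠ 0`.
    obtain ⟨r, rfl⟩ : ∃ r, m = 2 * n + r := ⟨m - 2 * n, by omega⟩
    have ih := ih (by omega)
    have hnr : (n : ℚ) + r ≠ 0 := by
      have : n + r ≠ 0 := by omega
      exact_mod_cast this
    have h1 : (((2 * n + r).choose (2 * n + 1) * (2 * n + 1).choose n : ℕ) : ℚ) =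
        r / (n + 1) * ((2 * n + r).choose (2 * n) * (2 * n).choose n) := by
      have e1 : (((2 * n + r).choose (2 * n + 1) : ℕ) : ℚ) * (2 * n + 1) =
          (2 * n + r).choose (2 * n) * r := by
        have := Nat.choose_succ_right_eq (2 * n + r) (2 * n)
        rw [Nat.add_sub_cancel_left] at this
        exact_mod_cast this
      have e2 : ((2 * n : ℚ) + 1) * (2 * n).choose n = (2 * n + 1).choose n * (n + 1) := by
        have := Nat.add_one_mul_choose_eq (2 * n) n
        rw [Nat.choose_symm_half] at this
        exact_mod_cast this
      have hpos : (2 * n : ℚ) + 1 ≠ 0 := by positivity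
      have hpos' : (n : ℚ) + 1 ≠ 0 := by positivity
      push_cast
      field_simp
      apply mul_left_cancel₀ hpos
      linear_combination ((2 * n + 1).choose n * (n + 1) : ℚ) * e1 -
        (((2 * n + r).choose (2 * n) : ℕ) : ℚ) * r * e2
    have h2 : (((2 * n + r).choose (2 * (n + 1)) * (2 * (n + 1)).choose (n + 1) : ℕ) : ℚ) =
        r * (r - 1) / (n + 1) ^ 2 * ((2 * n + r).choose (2 * n) * (2 * n).choose n) := by
      have e1 : (((2 * n + r).choose (2 * (n + 1)) : ℕ) : ℚ) * (2 * (n + 1)) =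
          (2 * n + r).choose (2 * n + 1) * (r - 1) := by
        rcases r with _ | r
        · rw [Nat.choose_eq_zero_of_lt (by omega), Nat.choose_eq_zero_of_lt (by omega)]
          simp
        · have := Nat.choose_succ_right_eq (2 * n + (r + 1)) (2 * n + 1)
          rw [show 2 * n + (r + 1) - (2 * n + 1) = r by omega] at this
          rw [Nat.cast_succ, add_sub_cancel_right]
          exact_mod_cast this
      have e2 : (((2 * (n + 1)).choose (n + 1) : ℕ) : ℚ) = 2 * (2 * n + 1).choose n := by
        rw [Nat.mul_succ, Nat.choose_succ_succ, Nat.choose_symm_half]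
        push_cast
        ring
      have hpos' : (n : ℚ) + 1 ≠ 0 := by positivity
      push_cast at h1 ⊢
      rw [e2]
      field_simp at h1 ⊢
      linear_combination ((2 * n + 1).choose n * (n + 1) : ℚ) * e1 + (r - 1 : ℚ) * h1
    have h3 : ∑ i ∈ Finset.Ico 1 (n + 1), ((2 * n + r + 1).choose i : ℚ) *
        ((2 * n + r - i - 1).choose (i - 1) : ℚ) = ∑ i ∈ Finset.Ico 1 n,
        ((2 * n + r + 1).choose i : ℚ) * ((2 * n + r - i - 1).choose (i - 1) : ℚ) +
        (2 * n + r + 1) * n / ((n + r + 1) * (n + r)) *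
          ((2 * n + r).choose (2 * n) * (2 * n).choose n) := by
      -- For `n = 0` the interval is empty and the added term has the factor `n`.
      rcases n with _ | k
      · simp
      · rw [Finset.sum_Ico_succ_top (by omega)]
        congr 1
        have c1 := Nat.cast_add_choose ℚ (a := k + 1) (b := k + r + 2)
        have c2 := Nat.cast_add_choose ℚ (a := k) (b := r)
        have c3 := Nat.cast_add_choose ℚ (a := 2 * (k + 1)) (b := r)
        have c4 := Nat.cast_add_choose ℚ (a := k + 1) (b := k + 1)
        rw [← two_mul] at c4
        have f1 : k + 1 + (k + r + 2) = 2 * (k + 1) + r + 1 := by ring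
        rw [f1] at c1
        rw [show 2 * (k + 1) + r - (k + 1) - 1 = k + r by omega, Nat.add_sub_cancel, c1, c2, c3, c4]
        have g1 : (k + r + 2).factorial = (k + r + 2) * ((k + r + 1) * (k + r).factorial) := rfl
        have g2 : (2 * (k + 1) + r + 1).factorial =
          (2 * (k + 1) + r + 1) * (2 * (k + 1) + r).factorial := rfl
        have g3 : (k + 1).factorial = (k + 1) * k.factorial := rfl
        have n1 : (k : ℚ) + 1 + r + 1 ≠ 0 := by positivity
        have n2 : (k : ℚ) + 1 + r ≠ 0 := by positivity
        have n3 : (k : ℚ) + r + 2 ≠ 0 := by positivity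
        have n4 : (k : ℚ) + r + 1 ≠ 0 := by positivity
        have n5 := fun i : ℕ => (Nat.cast_ne_zero (R := ℚ)).2 i.factorial_ne_zero
        have n6 := n5 (2 * (k + 1))
        have n7 := n5 (k + r)
        have n8 := n5 k
        have n9 := n5 r
        rw [g1, g2, g3]
        push_cast
        field_simp
        ring
    have hpos : (n : ℚ) + 1 ≠ 0 := by positivity
    have hpos1 : (n : ℚ) + r + 1 ≠ 0 := by positivity
    have hpos2 : (2 * n : ℚ) + r + 1 ≠ 0 := by positivity
    have e1 : (2 * n : ℚ) + r - n + 1 = n + r + 1 := by ring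
    have e2 : (2 * n : ℚ) + r - (n + 1) + 1 = n + r := by ring
    rw [Finset.sum_range_succ, h3]
    push_cast at h1 h2 ih ⊢
    rw [e1] at ih
    rw [e2, h2, h1]
    generalize ((2 * n + r).choose (2 * n) * (2 * n).choose n : ℚ) = X at *
    -- All new terms are rational multiples of `X`, so the induction step is an identity of rational
    -- functions in `n` and `r`.
    linear_combination (exp := 1) ih + X * (by
      field_simp
      ring : (1 - r / (n + 1) - 1 / (2 * n + r + 1) *
        ((2 * n + r + 1) * n / ((n + r + 1) * (n + r))) - n / (n + r + 1) +
        (n + 1) / (n + r) * (r * (r - 1) / (n + 1) ^ 2) : ℚ) = 0)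

theorem riordan_zero : riordan 0 = 1 := by
  have h := riordan_eq_sum_choose 0
  norm_num at h
  exact_mod_cast h

theorem riordan_eq {m : ℕ} (hm : 1 ≤ m) : (riordan m : ℚ) = 1 / ((m : ℚ) + 1) *
    ∑ i ∈ Finset.Icc 1 (m / 2), ((m + 1).choose i : ℚ) * ((m - i - 1).choose (i - 1) : ℚ) := by
  have h := sum_choose_telescope hm (m / 2 + 1) le_rfl
  rw [← riordan_eq_sum_choose, Nat.choose_eq_zero_of_lt (by omega : m < 2 * (m / 2 + 1)),
    Nat.cast_zero, zero_mul, mul_zero, sub_eq_zero] at h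
  rw [h]
  rfl

end Riordan

/-! ### Five-row constant terms in Catalan numbers. -/

section Moments

theorem catalan_succ_succ (n : ℕ) :
    ((n : ℚ) + 2) * catalan (n + 1) = 2 * (2 * n + 1) * catalan n := by
  have h1 : ((n : ℚ) + 1) * catalan n = n.centralBinom := by
    exact_mod_cast succ_mul_catalan_eq_centralBinom n
  have h2 : ((n : ℚ) + 1 + 1) * catalan (n + 1) = (n + 1).centralBinom := by
    exact_mod_cast succ_mul_catalan_eq_centralBinom (n + 1)
  have h3 : ((n : ℚ) + 1) * (n + 1).centralBinom = 2 * (2 * n + 1) * n.centralBinom := by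
    exact_mod_cast Nat.succ_mul_centralBinom_succ n
  have hpos : (n : ℚ) + 1 ≠ 0 := by positivity
  apply mul_left_cancel₀ hpos
  linear_combination ((n : ℚ) + 1) * h2 + h3 - 2 * (2 * n + 1) * h1

/-- Source of the factor `2 i / (i + 3)` in the five-row formulas. -/
theorem catalan_add_two_sub (n : ℕ) : (catalan (n + 2) : ℚ) - 2 * catalan (n + 1) =
    2 * (n : ℚ) / ((n : ℚ) + 3) * catalan (n + 1) := by
  have h := catalan_succ_succ (n + 1)
  have hpos : (n : ℚ) + 3 ≠ 0 := by positivity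
  push_cast at h
  field_simp
  linear_combination h

theorem constTerm_semicircle_binomial (i j m : ℕ) :
    constTerm _ ((4 - aVar ^ 2) * (4 - bVar ^ 2) *
      (aVar ^ i * bVar ^ j * (aVar * bVar + 1) ^ m)) = ∑ n ∈ Finset.range (m + 1),
        (m.choose n : ℚ) * (semicircleMoment (n + i) * semicircleMoment (n + j)) := by
  rw [add_pow, Finset.mul_sum, Finset.mul_sum, map_sum]
  refine Finset.sum_congr rfl fun n _ => ?_
  rw [← constTerm_semicircle_two, ← smul_eq_mul (m.choose n : ℚ), ← map_smul, Algebra.smul_def, map_natCast]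
  congr 1
  ring

/-- The generic count for at most five rows, `0` or `5` of which are odd. -/
noncomputable def fiveRowCount (m : ℕ) : ℚ := ∑ n ∈ Finset.range (m + 1), (m.choose n : ℚ) *
  (semicircleMoment (n + 2) * semicircleMoment n - semicircleMoment (n + 1) ^ 2) / 4

theorem constTerm_five (m : ℕ) :
    constTerm _ (1 * ((zVar + wVar + 1) ^ m * shapeWeight₅ 0)) = 8 * fiveRowCount m := by
  have hexp : 1 * ((zVar + wVar + 1) ^ m * shapeWeight₅ 0) =
      (4 - aVar ^ 2) * (4 - bVar ^ 2) * (aVar ^ 2 * bVar ^ 0 * (aVar * bVar + 1) ^ m) +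
      (4 - aVar ^ 2) * (4 - bVar ^ 2) * (aVar ^ 0 * bVar ^ 2 * (aVar * bVar + 1) ^ m) -
      2 • ((4 - aVar ^ 2) * (4 - bVar ^ 2) *
        (aVar ^ 1 * bVar ^ 1 * (aVar * bVar + 1) ^ m)) := by
    rw [zVar_add_wVar, shapeWeight₅_zero, nsmul_eq_mul, Nat.cast_two]
    ring
  rw [hexp, map_sub, map_add, map_nsmul, constTerm_semicircle_binomial,
    constTerm_semicircle_binomial, constTerm_semicircle_binomial, fiveRowCount, nsmul_eq_mul,
    Finset.mul_sum, Finset.mul_sum, ← Finset.sum_add_distrib, ← Finset.sum_sub_distrib]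
  refine Finset.sum_congr rfl fun n _ => ?_
  simp only [add_zero]
  push_cast
  ring

/-- The generic count for at most five rows, `2` or `3` of which are odd. -/
noncomputable def fiveRowCountTwo (m : ℕ) : ℚ := ∑ n ∈ Finset.range (m + 1), (m.choose n : ℚ) *
  (semicircleMoment (n + 4) * semicircleMoment n - semicircleMoment (n + 3) *
    semicircleMoment (n + 1) - 2 * semicircleMoment (n + 2) * semicircleMoment n +
    2 * semicircleMoment (n + 1) ^ 2) / 4

theorem constTerm_five_two (m : ℕ) : constTerm _ ((2 + zVar * wVar + (zVar + wVar)) *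
    ((zVar + wVar + 1) ^ m * shapeWeight₅ 0)) = 8 * fiveRowCountTwo m := by
  let M (i j : ℕ) : Laurent₂ := (4 - aVar ^ 2) * (4 - bVar ^ 2) *
    (aVar ^ i * bVar ^ j * (aVar * bVar + 1) ^ m)
  have hM : ∀ i j, constTerm _ (M i j) = ∑ n ∈ Finset.range (m + 1),
        (m.choose n : ℚ) * (semicircleMoment (n + i) * semicircleMoment (n + j)) :=
    fun i j => constTerm_semicircle_binomial i j m
  -- With `A = aVar` and `B = bVar`, this expands `(A² + B² - 2 + A B) (A - B)²`, the product of
  -- `e_2` with the additional factor of the density.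
  have hexp : (2 + zVar * wVar + (zVar + wVar)) * ((zVar + wVar + 1) ^ m * shapeWeight₅ 0) =
      M 4 0 + M 0 4 - M 3 1 - M 1 3 - 2 • M 2 0 - 2 • M 0 2 + 4 • M 1 1 := by
    simp only [M]
    rw [zVar_add_wVar, zVar_mul_wVar, shapeWeight₅_zero]
    simp only [nsmul_eq_mul]
    push_cast
    ring
  rw [hexp]
  simp only [map_sub, map_add, map_nsmul, hM]
  simp only [fiveRowCountTwo, nsmul_eq_mul, Finset.mul_sum, ← Finset.sum_add_distrib, ← Finset.sum_sub_distrib]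
  refine Finset.sum_congr rfl fun n _ => ?_
  simp only [add_zero]
  push_cast
  ring

theorem fiveRowCount_term_even (n : ℕ) : (semicircleMoment (2 * n + 2) * semicircleMoment (2 * n) -
    semicircleMoment (2 * n + 1) ^ 2) / 4 = (catalan n : ℚ) * catalan (n + 1) := by
  rw [semicircleMoment_add_two, semicircleMoment_two_mul, semicircleMoment_two_mul_add_one]
  ring

theorem fiveRowCount_term_odd (n : ℕ) : (semicircleMoment (2 * n + 1 + 2) *
    semicircleMoment (2 * n + 1) - semicircleMoment (2 * n + 1 + 1) ^ 2) / 4 =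
      -(catalan (n + 1) : ℚ) ^ 2 := by
  rw [add_assoc (2 * n) 1 1, semicircleMoment_add_two, semicircleMoment_two_mul_add_one]
  ring

theorem fiveRowCountTwo_term_even (n : ℕ) : (semicircleMoment (2 * n + 4) *
    semicircleMoment (2 * n) - semicircleMoment (2 * n + 3) * semicircleMoment (2 * n + 1) -
    2 * semicircleMoment (2 * n + 2) * semicircleMoment (2 * n) +
    2 * semicircleMoment (2 * n + 1) ^ 2) / 4 =
      2 * (n : ℚ) / ((n : ℚ) + 3) * catalan n * catalan (n + 1) := by
  rw [semicircleMoment_add_two, semicircleMoment_two_mul, semicircleMoment_two_mul_add_one,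
    semicircleMoment_add_four]
  linear_combination (catalan n : ℚ) * catalan_add_two_sub n

theorem fiveRowCountTwo_term_odd (n : ℕ) : (semicircleMoment (2 * n + 1 + 4) *
    semicircleMoment (2 * n + 1) - semicircleMoment (2 * n + 1 + 3) *
    semicircleMoment (2 * n + 1 + 1) - 2 * semicircleMoment (2 * n + 1 + 2) *
    semicircleMoment (2 * n + 1) + 2 * semicircleMoment (2 * n + 1 + 1) ^ 2) / 4 =
      -(2 * (n : ℚ) / ((n : ℚ) + 3) * (catalan (n + 1) : ℚ) ^ 2) := by
  rw [add_assoc (2 * n) 1 1, add_assoc (2 * n) 1 3, semicircleMoment_add_two,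
    semicircleMoment_add_four, semicircleMoment_two_mul_add_one]
  linear_combination -(catalan (n + 1) : ℚ) * catalan_add_two_sub n

theorem fiveRowCount_even (m : ℕ) : fiveRowCount (2 * m) =
    ∑ i ∈ Finset.range (m + 1),
        ((2 * m).choose (2 * i) : ℚ) * (catalan i : ℚ) * (catalan (i + 1) : ℚ) -
      ∑ i ∈ Finset.range m,
        ((2 * m).choose (2 * i + 1) : ℚ) * (catalan (i + 1) : ℚ) ^ 2 := by
  rw [fiveRowCount, Finset.sum_range_succ, sum_range_two_mul, Finset.sum_range_succ]
  simp only [mul_div_assoc, fiveRowCount_term_even, fiveRowCount_term_odd, mul_neg, mul_assoc,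
    Finset.sum_neg_distrib]
  ring

theorem fiveRowCount_odd (m : ℕ) : fiveRowCount (2 * m + 1) =
    ∑ i ∈ Finset.range (m + 1),
        ((2 * m + 1).choose (2 * i) : ℚ) * (catalan i : ℚ) * (catalan (i + 1) : ℚ) -
      ∑ i ∈ Finset.range (m + 1),
        ((2 * m + 1).choose (2 * i + 1) : ℚ) * (catalan (i + 1) : ℚ) ^ 2 := by
  rw [fiveRowCount, show 2 * m + 1 + 1 = 2 * (m + 1) by ring, sum_range_two_mul, sub_eq_add_neg,
    ← Finset.sum_neg_distrib]
  simp only [mul_div_assoc, fiveRowCount_term_even, fiveRowCount_term_odd, mul_neg, mul_assoc]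

theorem fiveRowCountTwo_even (m : ℕ) : fiveRowCountTwo (2 * m) =
    ∑ i ∈ Finset.range (m + 1), 2 * (i : ℚ) / ((i : ℚ) + 3) *
        ((2 * m).choose (2 * i) : ℚ) * (catalan i : ℚ) * (catalan (i + 1) : ℚ) -
      ∑ i ∈ Finset.range m, 2 * (i : ℚ) / ((i : ℚ) + 3) *
        ((2 * m).choose (2 * i + 1) : ℚ) * (catalan (i + 1) : ℚ) ^ 2 := by
  rw [fiveRowCountTwo, Finset.sum_range_succ, sum_range_two_mul, Finset.sum_range_succ]
  simp only [mul_div_assoc _ _ (4 : ℚ), fiveRowCountTwo_term_even, fiveRowCountTwo_term_odd]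
  rw [add_right_comm, sub_eq_add_neg, ← Finset.sum_neg_distrib]
  congr 1
  · congr 1
    · exact Finset.sum_congr rfl fun i _ => by ring
    · ring
  · exact Finset.sum_congr rfl fun i _ => by ring

theorem fiveRowCountTwo_odd (m : ℕ) : fiveRowCountTwo (2 * m + 1) =
    ∑ i ∈ Finset.range (m + 1), 2 * (i : ℚ) / ((i : ℚ) + 3) *
        ((2 * m + 1).choose (2 * i) : ℚ) * (catalan i : ℚ) * (catalan (i + 1) : ℚ) -
      ∑ i ∈ Finset.range (m + 1), 2 * (i : ℚ) / ((i : ℚ) + 3) *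
        ((2 * m + 1).choose (2 * i + 1) : ℚ) * (catalan (i + 1) : ℚ) ^ 2 := by
  rw [fiveRowCountTwo, show 2 * m + 1 + 1 = 2 * (m + 1) by ring, sum_range_two_mul, sub_eq_add_neg,
    ← Finset.sum_neg_distrib]
  simp only [mul_div_assoc _ _ (4 : ℚ), fiveRowCountTwo_term_even, fiveRowCountTwo_term_odd]
  congr 1
  · exact Finset.sum_congr rfl fun i _ => by ring
  · exact Finset.sum_congr rfl fun i _ => by ring

end Moments

/-! ### Counts for at most five rows. -/

section FiveRows

theorem ncard_five_zero_add (m : ℕ) :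
    ((SYTOdd 5 0 m).ncard : ℚ) + (SYTOdd 5 5 m).ncard = fiveRowCount m := by
  have h := ncard_SYTOdd_add (constTerm _) shapeWeight₅_eq_zero sum_shapeWeight₅
    (fun _ => constTerm_shapeWeight₅) m
  rw [constTerm_five] at h
  linear_combination h / 8

theorem ncard_five_one_add (m : ℕ) :
    ((SYTOdd 5 1 m).ncard : ℚ) + (SYTOdd 5 4 m).ncard = fiveRowCount (m + 1) := by
  have h := ncard_SYTOdd_add (constTerm _) shapeWeight₅_eq_zero sum_shapeWeight₅
    (fun _ => constTerm_mul_shapeWeight₅) m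
  -- The multiplier `e_1` equals the trace, so it only raises the exponent by one.
  rw [← mul_assoc, ← pow_succ', ← one_mul (_ * shapeWeight₅ 0), constTerm_five] at h
  linear_combination h / 8

theorem ncard_five_two_add (m : ℕ) :
    ((SYTOdd 5 2 m).ncard : ℚ) + (SYTOdd 5 3 m).ncard = fiveRowCountTwo m := by
  have h := ncard_SYTOdd_add (constTerm _) shapeWeight₅_eq_zero sum_shapeWeight₅
    (fun _ => constTerm_two_mul_shapeWeight₅) m
  rw [constTerm_five_two] at h
  linear_combination h / 8

end FiveRows

/-! ### Counts for at most four rows, from both components of `O(4)`. -/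

section FourRows

theorem constTerm_four (i j m : ℕ) :
    constTerm _ ((4 - aVar ^ 2) * (4 - bVar ^ 2) * (aVar ^ i * bVar ^ j * (aVar * bVar) ^ m)) =
      semicircleMoment (m + i) * semicircleMoment (m + j) := by
  rw [← constTerm_semicircle_two]
  congr 1
  ring

theorem ncard_four_zero_add (m : ℕ) :
    ((SYTOdd 4 0 (2 * m)).ncard : ℚ) + (SYTOdd 4 4 (2 * m)).ncard = (catalan m : ℚ) ^ 2 := by
  have h := ncard_SYTOdd_add (constTerm _) shapeWeight₄_eq_zero sum_shapeWeight₄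
    (fun _ => constTerm_shapeWeight₄) (2 * m)
  have h2 := constTerm_four 0 0 (2 * m)
  rw [add_zero, semicircleMoment_two_mul] at h2
  have h3 : 1 * ((zVar + wVar) ^ (2 * m) * shapeWeight₄ 0) = (4 - aVar ^ 2) * (4 - bVar ^ 2) *
      (aVar ^ 0 * bVar ^ 0 * (aVar * bVar) ^ (2 * m)) := by
    rw [shapeWeight₄_zero, zVar_add_wVar]
    ring
  rw [h3, h2] at h
  linear_combination h / 4

theorem ncard_four_one_add (m : ℕ) :
    ((SYTOdd 4 1 (2 * m + 1)).ncard : ℚ) + (SYTOdd 4 3 (2 * m + 1)).ncard =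
      (catalan (m + 1) : ℚ) ^ 2 := by
  have h := ncard_SYTOdd_add (constTerm _) shapeWeight₄_eq_zero sum_shapeWeight₄
    (fun _ => constTerm_mul_shapeWeight₄) (2 * m + 1)
  have h2 := constTerm_four 0 0 (2 * (m + 1))
  rw [add_zero, semicircleMoment_two_mul] at h2
  have h3 : (zVar + wVar) * ((zVar + wVar) ^ (2 * m + 1) * shapeWeight₄ 0) =
      (4 - aVar ^ 2) * (4 - bVar ^ 2) *
        (aVar ^ 0 * bVar ^ 0 * (aVar * bVar) ^ (2 * (m + 1))) := by
    rw [shapeWeight₄_zero, zVar_add_wVar]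
    ring
  rw [h3, h2] at h
  linear_combination h / 4

theorem ncard_four_two (m : ℕ) : ((SYTOdd 4 2 (2 * m)).ncard : ℚ) =
    (catalan m : ℚ) * (catalan (m + 1) : ℚ) - (catalan m : ℚ) ^ 2 := by
  have h := ncard_SYTOdd_add (constTerm _) shapeWeight₄_eq_zero sum_shapeWeight₄
    (fun _ => constTerm_two_mul_shapeWeight₄) (2 * m)
  have h20 := constTerm_four 2 0 (2 * m)
  have h02 := constTerm_four 0 2 (2 * m)
  have h00 := constTerm_four 0 0 (2 * m)
  rw [add_zero, semicircleMoment_two_mul] at h20 h02 h00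
  rw [semicircleMoment_add_two] at h20 h02
  have h3 : (2 + zVar * wVar) * ((zVar + wVar) ^ (2 * m) * shapeWeight₄ 0) =
      (4 - aVar ^ 2) * (4 - bVar ^ 2) * (aVar ^ 2 * bVar ^ 0 * (aVar * bVar) ^ (2 * m)) +
      (4 - aVar ^ 2) * (4 - bVar ^ 2) * (aVar ^ 0 * bVar ^ 2 * (aVar * bVar) ^ (2 * m)) -
      2 • ((4 - aVar ^ 2) * (4 - bVar ^ 2) *
        (aVar ^ 0 * bVar ^ 0 * (aVar * bVar) ^ (2 * m))) := by
    rw [shapeWeight₄_zero, zVar_add_wVar, zVar_mul_wVar, nsmul_eq_mul, Nat.cast_two]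
    ring
  rw [h3, map_sub, map_add, map_nsmul, h20, h02, h00, nsmul_eq_mul, Nat.cast_two] at h
  -- The factor is `4` for the Weyl group of `SO(4)` times `2` for the doubled indicator.
  linear_combination h / 8

/-- On the component of determinant `-1` the trace is `x + x⁻¹` with density `4 - tPlusInv ^ 2`, so
a single semicircle moment remains. -/
theorem ncard_four_zero_sub (m : ℕ) :
    ((SYTOdd 4 0 (2 * m)).ncard : ℚ) - (SYTOdd 4 4 (2 * m)).ncard = catalan m := by
  have h := ncard_SYTOdd_add (constTerm _) shapeSignWeight₄_eq_zero sum_shapeSignWeight₄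
    (fun _ => constTerm_shapeSignWeight₄) (2 * m)
  rw [shapeSignWeight₄_zero, one_mul, mul_comm (tPlusInv ^ _), constTerm_semicircle_even] at h
  linear_combination h / 2

theorem ncard_four_one_sub (m : ℕ) :
    ((SYTOdd 4 1 (2 * m + 1)).ncard : ℚ) - (SYTOdd 4 3 (2 * m + 1)).ncard = catalan (m + 1) := by
  have h := ncard_SYTOdd_add (constTerm _) shapeSignWeight₄_eq_zero sum_shapeSignWeight₄
    (fun _ => constTerm_mul_shapeSignWeight₄) (2 * m + 1)
  rw [shapeSignWeight₄_zero, ← mul_assoc, ← pow_succ', mul_comm (tPlusInv ^ _),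
    show 2 * m + 1 + 1 = 2 * (m + 1) by ring, constTerm_semicircle_even] at h
  linear_combination h / 2

theorem ncard_four_zero (m : ℕ) : (SYTOdd 4 0 (2 * m)).ncard = (catalan m + 1).choose 2 := by
  have h : ((SYTOdd 4 0 (2 * m)).ncard : ℚ) = ((catalan m + 1).choose 2 : ℕ) := by
    rw [Nat.cast_choose_two, Nat.cast_add_one]
    linear_combination (ncard_four_zero_add m + ncard_four_zero_sub m) / 2
  exact_mod_cast h

theorem ncard_four_four (m : ℕ) : (SYTOdd 4 4 (2 * m)).ncard = (catalan m).choose 2 := by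
  have h : ((SYTOdd 4 4 (2 * m)).ncard : ℚ) = ((catalan m).choose 2 : ℕ) := by
    rw [Nat.cast_choose_two]
    linear_combination (ncard_four_zero_add m - ncard_four_zero_sub m) / 2
  exact_mod_cast h

theorem ncard_four_one (m : ℕ) :
    (SYTOdd 4 1 (2 * m + 1)).ncard = (catalan (m + 1) + 1).choose 2 := by
  have h : ((SYTOdd 4 1 (2 * m + 1)).ncard : ℚ) = ((catalan (m + 1) + 1).choose 2 : ℕ) := by
    rw [Nat.cast_choose_two, Nat.cast_add_one]
    linear_combination (ncard_four_one_add m + ncard_four_one_sub m) / 2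
  exact_mod_cast h

theorem ncard_four_three (m : ℕ) :
    (SYTOdd 4 3 (2 * m + 1)).ncard = (catalan (m + 1)).choose 2 := by
  have h : ((SYTOdd 4 3 (2 * m + 1)).ncard : ℚ) = ((catalan (m + 1)).choose 2 : ℕ) := by
    rw [Nat.cast_choose_two]
    linear_combination (ncard_four_one_add m - ncard_four_one_sub m) / 2
  exact_mod_cast h

theorem catalan_mul_catalan_sub (n : ℕ) :
    (catalan (n + 1) : ℚ) * (catalan (n + 2) : ℚ) - (catalan (n + 1) : ℚ) ^ 2 =
      3 * ((2 * (n + 1)).factorial : ℚ) ^ 2 / ((n.factorial : ℚ) * ((n + 1).factorial : ℚ) *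
        ((n + 2).factorial : ℚ) * ((n + 3).factorial : ℚ)) := by
  have h1 := catalan_succ_succ (n + 1)
  have h2 : ((n : ℚ) + 1 + 1) * catalan (n + 1) = (2 * (n + 1)).choose (n + 1) := by
    exact_mod_cast succ_mul_catalan_eq_centralBinom (n + 1)
  have h3 := Nat.cast_add_choose ℚ (a := n + 1) (b := n + 1)
  rw [← two_mul] at h3
  have n0 := (Nat.cast_ne_zero (R := ℚ)).2 n.factorial_ne_zero
  have p1 : (n : ℚ) + 1 ≠ 0 := by positivity
  have p2 : (n : ℚ) + 2 ≠ 0 := by positivity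
  have p3 : (n : ℚ) + 3 ≠ 0 := by positivity
  have g1 : (n + 1).factorial = (n + 1) * n.factorial := rfl
  have g2 : (n + 2).factorial = (n + 2) * ((n + 1) * n.factorial) := rfl
  have g3 : (n + 3).factorial = (n + 3) * ((n + 2) * ((n + 1) * n.factorial)) := rfl
  have h4 : (catalan (n + 2) : ℚ) = 2 * (2 * n + 3) * catalan (n + 1) / (n + 3) := by
    push_cast at h1
    field_simp
    linear_combination h1
  have h5 : ((2 * (n + 1)).factorial : ℚ) =
      (n + 2) * catalan (n + 1) * ((n + 1) * n.factorial) ^ 2 := by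
    rw [g1] at h3
    push_cast at h3
    rw [h3] at h2
    field_simp at h2
    linear_combination -h2
  rw [h4, h5, g1, g2, g3]
  push_cast
  field_simp
  ring

end FourRows

/-! ### Counts for at most three rows, and degenerate cases. -/

section FewRows

theorem ncard_three_zero_add (m : ℕ) :
    (SYTOdd 3 0 m).ncard + (SYTOdd 3 3 m).ncard = riordan m := by
  have h := ncard_SYTOdd_add (constTerm _) shapeWeight₃_eq_zero sum_shapeWeight₃
    (fun _ => constTerm_shapeWeight₃) m
  simp only [one_mul] at h
  rw [shapeWeight₃_zero, mul_comm ((tPlusInv + 1) ^ _), ← two_mul_riordan] at h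
  have h2 : ((SYTOdd 3 0 m).ncard : ℚ) + (SYTOdd 3 3 m).ncard = riordan m := by
    linear_combination h / 2
  exact_mod_cast h2

theorem ncard_three_one_add (m : ℕ) :
    (SYTOdd 3 1 m).ncard + (SYTOdd 3 2 m).ncard = riordan (m + 1) := by
  have h := ncard_SYTOdd_add (constTerm _) shapeWeight₃_eq_zero sum_shapeWeight₃
    (fun _ => constTerm_mul_shapeWeight₃) m
  rw [shapeWeight₃_zero, ← mul_assoc, ← pow_succ', mul_comm ((tPlusInv + 1) ^ _),
    ← two_mul_riordan] at h
  have h2 : ((SYTOdd 3 1 m).ncard : ℚ) + (SYTOdd 3 2 m).ncard = riordan (m + 1) := by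
    linear_combination h / 2
  exact_mod_cast h2

theorem constTerm_tPlusInv_pow_two_mul (n : ℕ) :
    constTerm ℤ (tPlusInv ^ (2 * (n + 1))) = 2 * ((2 * n + 1).choose (n + 1) : ℚ) := by
  rw [constTerm_tPlusInv_pow, if_pos (even_two_mul _), Nat.mul_div_cancel_left _ two_pos,
    Nat.mul_succ, Nat.choose_succ_succ, ← Nat.choose_symm_half]
  push_cast
  ring

theorem ncard_two_zero_add (n : ℕ) : ((SYTOdd 2 0 (2 * (n + 1))).ncard : ℚ) +
    (SYTOdd 2 2 (2 * (n + 1))).ncard = 2 * ((2 * n + 1).choose (n + 1) : ℚ) := by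
  have h := ncard_SYTOdd_add (constTerm _) shapeWeight₂_eq_zero sum_shapeWeight₂
    (fun _ => constTerm_shapeWeight₂) (2 * (n + 1))
  simp only [one_mul] at h
  rw [shapeWeight₂_zero, mul_one, constTerm_tPlusInv_pow_two_mul] at h
  linear_combination h

/-- Reflections in `O(2)` have trace `0`, so the difference vanishes as soon as there is a cell. -/
theorem ncard_two_zero_sub (n : ℕ) : ((SYTOdd 2 0 (2 * (n + 1))).ncard : ℚ) -
    (SYTOdd 2 2 (2 * (n + 1))).ncard = 0 := by
  have h := ncard_SYTOdd_add LinearMap.id shapeSignWeight₂_eq_zero sum_shapeSignWeight₂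
    (fun l _ => shapeSignWeight₂_eq l) (2 * (n + 1))
  rw [zero_pow (by omega), zero_mul, mul_zero, map_zero] at h
  linear_combination h

theorem ncard_two_zero (n : ℕ) :
    (SYTOdd 2 0 (2 * (n + 1))).ncard = (2 * n + 1).choose (n + 1) := by
  have h : ((SYTOdd 2 0 (2 * (n + 1))).ncard : ℚ) = (2 * n + 1).choose (n + 1) := by
    linear_combination (ncard_two_zero_add n + ncard_two_zero_sub n) / 2
  exact_mod_cast h

theorem ncard_two_two (n : ℕ) :
    (SYTOdd 2 2 (2 * (n + 1))).ncard = (2 * n + 1).choose (n + 1) := by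
  have h : ((SYTOdd 2 2 (2 * (n + 1))).ncard : ℚ) = (2 * n + 1).choose (n + 1) := by
    linear_combination (ncard_two_zero_add n - ncard_two_zero_sub n) / 2
  exact_mod_cast h

theorem ncard_two_one (n : ℕ) :
    (SYTOdd 2 1 (2 * n + 1)).ncard = (2 * n + 1).choose (n + 1) := by
  have h := ncard_SYTOdd_add (constTerm _) shapeWeight₂_eq_zero sum_shapeWeight₂
    (fun _ => constTerm_mul_shapeWeight₂) (2 * n + 1)
  rw [shapeWeight₂_zero, mul_one, ← pow_succ', show 2 * n + 1 + 1 = 2 * (n + 1) by ring,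
    constTerm_tPlusInv_pow_two_mul] at h
  have h : ((SYTOdd 2 1 (2 * n + 1)).ncard : ℚ) = (2 * n + 1).choose (n + 1) := by
    linear_combination h / 2
  exact_mod_cast h

/-- The case of the trivial group `SO(1)`: weight and trace are both `1`. -/
theorem ncard_one_add (m : ℕ) : (SYTOdd 1 0 m).ncard + (SYTOdd 1 1 m).ncard = 1 := by
  have h := ncard_SYTOdd_add (LinearMap.id (R := ℚ)) (k := 1) (F := fun _ => 1) (p := 1)
    (X := 1) (c := 1) (s := 1) (t := 0) (t' := 1) (by omega) (by simp) (fun l _ => by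
      rcases Nat.mod_two_eq_zero_or_one (l 0) with h0 | h0 <;> simp [oddCount, h0]) m
  simp only [one_pow, one_mul, LinearMap.id_apply] at h
  exact_mod_cast h

theorem SYTOdd_eq_empty_of_lt {k t m : ℕ} (h : k < t) : SYTOdd k t m = ∅ := by
  refine Set.eq_empty_of_forall_notMem fun T ⟨_, _, h3, h4⟩ => ?_
  have := List.countP_le_length (p := fun a => decide (Odd a)) (l := T.1.rowLens)
  rw [numOdd] at h4
  omega

theorem SYTOdd_zero_eq_empty {m : ℕ} (hm : 1 ≤ m) : SYTOdd 0 0 m = ∅ := by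
  refine Set.eq_empty_of_forall_notMem fun T ⟨_, h2, h3, _⟩ => ?_
  have h := sum_rowLens T.1
  rw [List.length_eq_zero_iff.1 (Nat.le_zero.1 h3), List.sum_nil] at h
  omega

theorem ncard_SYTOdd_zero_cells (k t : ℕ) :
    (SYTOdd k t 0).ncard = if t = 0 then 1 else 0 := by
  rw [ncard_SYTOdd, sum_standardTableaux_zero k fun l => if oddCount k l = t then 1 else 0]
  simp [oddCount, eq_comm]

theorem AlmostEvenTableaux_eq_empty {k m : ℕ}
    (h : (SYTOdd k (if Odd m then 1 else 2) m).ncard = 0) : AlmostEvenTableaux k m = ∅ := by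
  rw [← Set.ncard_eq_zero (finite_AlmostEvenTableaux k m), ncard_almostEvenTableaux, h]

theorem ncard_almostEvenTableaux_even (k m : ℕ) :
    (AlmostEvenTableaux k (2 * m)).ncard = (SYTOdd k 2 (2 * m)).ncard := by
  rw [ncard_almostEvenTableaux, if_neg (by simp)]

theorem ncard_almostEvenTableaux_odd (k m : ℕ) :
    (AlmostEvenTableaux k (2 * m + 1)).ncard = (SYTOdd k 1 (2 * m + 1)).ncard := by
  rw [ncard_almostEvenTableaux, if_pos ⟨m, rfl⟩]

end FewRows

/-! ### Assembly: the parity of the number of cells removes one of the two counts in each sum with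
odd `k`. -/

theorem mainTheorem6 :
    -- degenerate cases: parity, no cells, and `k = 0, 1`
    (∀ k t m : ℕ, t ≤ k → k ≤ 5 → m % 2 ≠ t % 2 → SYTOdd k t m = ∅) ∧
    (∀ k t : ℕ, t ≤ k → k ≤ 5 → (SYTOdd k t 0).ncard = if t = 0 then 1 else 0) ∧
    (∀ k : ℕ, k ≤ 5 → AlmostEvenTableaux k 0 = ∅) ∧
    (∀ m : ℕ, 1 ≤ m → SYTOdd 0 0 m = ∅ ∧ AlmostEvenTableaux 0 m = ∅) ∧
    (∀ m : ℕ, (SYTOdd 1 0 (2 * m)).ncard = 1 ∧ AlmostEvenTableaux 1 (2 * m) = ∅) ∧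
    (∀ m : ℕ, 1 ≤ m →
      (SYTOdd 1 1 (2 * m - 1)).ncard = 1 ∧ (AlmostEvenTableaux 1 (2 * m - 1)).ncard = 1) ∧
    -- the Riordan numbers in closed form
    riordan 0 = 1 ∧
    (∀ m : ℕ, 1 ≤ m →
      (riordan m : ℚ) = 1 / ((m : ℚ) + 1) *
        ∑ i ∈ Finset.Icc 1 (m / 2),
          ((m + 1).choose i : ℚ) * ((m - i - 1).choose (i - 1) : ℚ)) ∧
    -- `k = 2`
    (∀ m : ℕ, 1 ≤ m →
      (SYTOdd 2 0 (2 * m)).ncard = (2 * m - 1).choose m ∧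
      (SYTOdd 2 1 (2 * m - 1)).ncard = (2 * m - 1).choose m ∧
      (SYTOdd 2 2 (2 * m)).ncard = (2 * m - 1).choose m ∧
      (AlmostEvenTableaux 2 (2 * m - 1)).ncard = (2 * m - 1).choose m ∧
      (AlmostEvenTableaux 2 (2 * m)).ncard = (2 * m - 1).choose m) ∧
    -- `k = 3`
    (∀ m : ℕ,
      (SYTOdd 3 0 (2 * m)).ncard = riordan (2 * m) ∧
      (SYTOdd 3 2 (2 * m)).ncard = riordan (2 * m + 1) ∧
      (SYTOdd 3 3 (2 * m + 1)).ncard = riordan (2 * m + 1) ∧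
      (AlmostEvenTableaux 3 (2 * m)).ncard = riordan (2 * m + 1)) ∧
    (∀ m : ℕ, 1 ≤ m →
      (SYTOdd 3 1 (2 * m - 1)).ncard = riordan (2 * m) ∧
      (AlmostEvenTableaux 3 (2 * m - 1)).ncard = riordan (2 * m)) ∧
    -- `k = 4`
    (∀ m : ℕ,
      (SYTOdd 4 0 (2 * m)).ncard = (catalan m + 1).choose 2 ∧
      ((SYTOdd 4 2 (2 * m)).ncard : ℚ) =
        (catalan m : ℚ) * (catalan (m + 1) : ℚ) - (catalan m : ℚ) ^ 2 ∧
      ((AlmostEvenTableaux 4 (2 * m)).ncard : ℚ) =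
        (catalan m : ℚ) * (catalan (m + 1) : ℚ) - (catalan m : ℚ) ^ 2 ∧
      (SYTOdd 4 4 (2 * m)).ncard = (catalan m).choose 2) ∧
    (∀ m : ℕ, 1 ≤ m →
      (SYTOdd 4 1 (2 * m - 1)).ncard = (catalan m + 1).choose 2 ∧
      (AlmostEvenTableaux 4 (2 * m - 1)).ncard = (catalan m + 1).choose 2 ∧
      (catalan m : ℚ) * (catalan (m + 1) : ℚ) - (catalan m : ℚ) ^ 2 =
        3 * ((2 * m).factorial : ℚ) ^ 2 /
          (((m - 1).factorial : ℚ) * (m.factorial : ℚ) * ((m + 1).factorial : ℚ) *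
            ((m + 2).factorial : ℚ)) ∧
      (SYTOdd 4 3 (2 * m - 1)).ncard = (catalan m).choose 2) ∧
    -- `k = 5`
    (∀ m : ℕ,
      ((SYTOdd 5 0 (2 * m)).ncard : ℚ) =
        ∑ i ∈ Finset.range (m + 1),
            ((2 * m).choose (2 * i) : ℚ) * (catalan i : ℚ) * (catalan (i + 1) : ℚ) -
          ∑ i ∈ Finset.range m,
            ((2 * m).choose (2 * i + 1) : ℚ) * (catalan (i + 1) : ℚ) ^ 2 ∧
      ((SYTOdd 5 2 (2 * m)).ncard : ℚ) =
        ∑ i ∈ Finset.range (m + 1), 2 * (i : ℚ) / ((i : ℚ) + 3) *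
            ((2 * m).choose (2 * i) : ℚ) * (catalan i : ℚ) * (catalan (i + 1) : ℚ) -
          ∑ i ∈ Finset.range m, 2 * (i : ℚ) / ((i : ℚ) + 3) *
            ((2 * m).choose (2 * i + 1) : ℚ) * (catalan (i + 1) : ℚ) ^ 2 ∧
      ((AlmostEvenTableaux 5 (2 * m)).ncard : ℚ) =
        ∑ i ∈ Finset.range (m + 1), 2 * (i : ℚ) / ((i : ℚ) + 3) *
            ((2 * m).choose (2 * i) : ℚ) * (catalan i : ℚ) * (catalan (i + 1) : ℚ) -
          ∑ i ∈ Finset.range m, 2 * (i : ℚ) / ((i : ℚ) + 3) *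
            ((2 * m).choose (2 * i + 1) : ℚ) * (catalan (i + 1) : ℚ) ^ 2) ∧
    (∀ m : ℕ, 1 ≤ m →
      ((SYTOdd 5 1 (2 * m - 1)).ncard : ℚ) =
        ∑ i ∈ Finset.range (m + 1),
            ((2 * m).choose (2 * i) : ℚ) * (catalan i : ℚ) * (catalan (i + 1) : ℚ) -
          ∑ i ∈ Finset.range m,
            ((2 * m).choose (2 * i + 1) : ℚ) * (catalan (i + 1) : ℚ) ^ 2 ∧
      ((AlmostEvenTableaux 5 (2 * m - 1)).ncard : ℚ) =
        ∑ i ∈ Finset.range (m + 1),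
            ((2 * m).choose (2 * i) : ℚ) * (catalan i : ℚ) * (catalan (i + 1) : ℚ) -
          ∑ i ∈ Finset.range m,
            ((2 * m).choose (2 * i + 1) : ℚ) * (catalan (i + 1) : ℚ) ^ 2 ∧
      ((SYTOdd 5 3 (2 * m - 1)).ncard : ℚ) =
        ∑ i ∈ Finset.range m, 2 * (i : ℚ) / ((i : ℚ) + 3) *
            ((2 * m - 1).choose (2 * i) : ℚ) * (catalan i : ℚ) * (catalan (i + 1) : ℚ) -
          ∑ i ∈ Finset.range m, 2 * (i : ℚ) / ((i : ℚ) + 3) *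
            ((2 * m - 1).choose (2 * i + 1) : ℚ) * (catalan (i + 1) : ℚ) ^ 2 ∧
      ((SYTOdd 5 4 (2 * m - 2)).ncard : ℚ) =
        ∑ i ∈ Finset.range m,
            ((2 * m - 1).choose (2 * i) : ℚ) * (catalan i : ℚ) * (catalan (i + 1) : ℚ) -
          ∑ i ∈ Finset.range m,
            ((2 * m - 1).choose (2 * i + 1) : ℚ) * (catalan (i + 1) : ℚ) ^ 2 ∧
      ((SYTOdd 5 5 (2 * m - 1)).ncard : ℚ) =
        ∑ i ∈ Finset.range m,
            ((2 * m - 1).choose (2 * i) : ℚ) * (catalan i : ℚ) * (catalan (i + 1) : ℚ) -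
          ∑ i ∈ Finset.range m,
            ((2 * m - 1).choose (2 * i + 1) : ℚ) * (catalan (i + 1) : ℚ) ^ 2) := by
  refine ⟨fun k t m _ _ h => SYTOdd_eq_empty h, fun k t _ _ => ncard_SYTOdd_zero_cells k t,
    fun k _ => AlmostEvenTableaux_eq_empty ?_, fun m hm => ⟨SYTOdd_zero_eq_empty hm, ?_⟩,
    fun m => ⟨?_, AlmostEvenTableaux_eq_empty ?_⟩, fun m hm => ?_, riordan_zero,
    fun m hm => riordan_eq hm, fun m hm => ?_, fun m => ?_, fun m hm => ?_, fun m => ?_,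
    fun m hm => ?_, fun m => ?_, fun m hm => ?_⟩
  · rw [if_neg (by simp), ncard_SYTOdd_zero_cells, if_neg two_ne_zero]
  · refine AlmostEvenTableaux_eq_empty ?_
    rw [SYTOdd_eq_empty_of_lt (by split_ifs <;> norm_num), Set.ncard_empty]
  · have h := ncard_one_add (2 * m)
    rwa [ncard_SYTOdd_of_mod_ne (t := 1) (by omega), add_zero] at h
  · rw [if_neg (by simp), SYTOdd_eq_empty_of_lt one_lt_two, Set.ncard_empty]
  · obtain ⟨n, rfl⟩ : ∃ n, m = n + 1 := ⟨m - 1, by omega⟩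
    have h := ncard_one_add (2 * n + 1)
    rw [ncard_SYTOdd_of_mod_ne (t := 0) (by omega), zero_add] at h
    rw [show 2 * (n + 1) - 1 = 2 * n + 1 by omega, ncard_almostEvenTableaux_odd]
    exact ⟨h, h⟩
  · obtain ⟨n, rfl⟩ : ∃ n, m = n + 1 := ⟨m - 1, by omega⟩
    rw [show 2 * (n + 1) - 1 = 2 * n + 1 by omega, ncard_almostEvenTableaux_odd,
      ncard_almostEvenTableaux_even]
    exact ⟨ncard_two_zero n, ncard_two_one n, ncard_two_two n, ncard_two_one n, ncard_two_two n⟩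
  · have h0 := ncard_three_zero_add (2 * m)
    have h2 := ncard_three_one_add (2 * m)
    have h3 := ncard_three_zero_add (2 * m + 1)
    rw [ncard_SYTOdd_of_mod_ne (t := 3) (by omega), add_zero] at h0
    rw [ncard_SYTOdd_of_mod_ne (t := 1) (by omega), zero_add] at h2
    rw [ncard_SYTOdd_of_mod_ne (t := 0) (by omega), zero_add] at h3
    rw [ncard_almostEvenTableaux_even]
    exact ⟨h0, h2, h3, h2⟩
  · obtain ⟨n, rfl⟩ : ∃ n, m = n + 1 := ⟨m - 1, by omega⟩
    have h1 := ncard_three_one_add (2 * n + 1)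
    rw [ncard_SYTOdd_of_mod_ne (t := 2) (by omega), add_zero] at h1
    rw [show 2 * (n + 1) - 1 = 2 * n + 1 by omega, ncard_almostEvenTableaux_odd]
    exact ⟨h1, h1⟩
  · rw [ncard_almostEvenTableaux_even]
    exact ⟨ncard_four_zero m, ncard_four_two m, ncard_four_two m, ncard_four_four m⟩
  · obtain ⟨n, rfl⟩ : ∃ n, m = n + 1 := ⟨m - 1, by omega⟩
    rw [show 2 * (n + 1) - 1 = 2 * n + 1 by omega, ncard_almostEvenTableaux_odd]
    exact ⟨ncard_four_one n, ncard_four_one n, catalan_mul_catalan_sub n, ncard_four_three n⟩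
  · have h0 := ncard_five_zero_add (2 * m)
    have h2 := ncard_five_two_add (2 * m)
    rw [ncard_SYTOdd_of_mod_ne (t := 5) (by omega), Nat.cast_zero, add_zero,
      fiveRowCount_even] at h0
    rw [ncard_SYTOdd_of_mod_ne (t := 3) (by omega), Nat.cast_zero, add_zero,
      fiveRowCountTwo_even] at h2
    rw [ncard_almostEvenTableaux_even]
    exact ⟨h0, h2, h2⟩
  · obtain ⟨n, rfl⟩ : ∃ n, m = n + 1 := ⟨m - 1, by omega⟩
    have h1 := ncard_five_one_add (2 * n + 1)
    have h3 := ncard_five_two_add (2 * n + 1)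
    have h4 := ncard_five_one_add (2 * n)
    have h5 := ncard_five_zero_add (2 * n + 1)
    rw [ncard_SYTOdd_of_mod_ne (t := 4) (by omega), Nat.cast_zero, add_zero,
      show 2 * n + 1 + 1 = 2 * (n + 1) by ring, fiveRowCount_even] at h1
    rw [ncard_SYTOdd_of_mod_ne (t := 2) (by omega), Nat.cast_zero, zero_add,
      fiveRowCountTwo_odd] at h3
    rw [ncard_SYTOdd_of_mod_ne (t := 1) (by omega), Nat.cast_zero, zero_add,
      fiveRowCount_odd] at h4
    rw [ncard_SYTOdd_of_mod_ne (t := 0) (by omega), Nat.cast_zero, zero_add,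
      fiveRowCount_odd] at h5
    rw [show 2 * (n + 1) - 1 = 2 * n + 1 by omega, show 2 * (n + 1) - 2 = 2 * n by omega,
      ncard_almostEvenTableaux_odd]
    exact ⟨h1, h1, h3, h4, h5⟩
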